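/- **Theorem (derivation of the Vlasov equation).** Let $d\in\mathbf N$ and let $\Phi:\mathbf R^d\to\mathbf R$ be even, with Fourier transform $\widehat\Phi\in L^1(\mathbf R^d)$ normalized by $\Phi(x)=\int_{\mathbf R^d}\widehat\Phi(h)e^{ih\cdot x}\,dh$ (formally $\widehat\Phi(h)=(2\pi)^{-d}\int\Phi(x)e^{-ih\cdot x}dx$). For $g\in L^1((\mathbf R^d\times\mathbf R^d)^n)$ and $\rho>0$ put $$\widetilde g(\xi,\eta)=\int e^{i\sum_{k=1}^n(x_k\cdot\xi_k-v_k\cdot\eta_k)}g(x,v)\,dx\,dv,\qquad \|g\|_\rho=\sup_{\xi,\eta\in(\mathbf R^d)^n}|\widetilde g(\xi,\eta)|\,e^{\rho\sum_{k=1}^n(|\xi_k|+|\eta_k|)}\in[0,\infty].$$ Let $f^{in}$ be a probability density on $\mathbf R^d\times\mathbf R^d$ and let $0<\beta<\beta'$ be such that $$M:=\|f^{in}\|_{\beta'}<\infty\quad\text{and}\quad\int_{\mathbf R^d}|h|\,|\widehat\Phi(h)|\,e^{\beta'|h|}\,dh<\infty .$$ Put $\alpha=\log M+\log 2$, $\;C_\Phi^{\beta'}(s)=\int_{\mathbf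 R^d}|h|\,|\widehat\Phi(h)|\,e^{2\beta'|h|(1+|s|)}\,dh\in[0,\infty]$, and consider the equation $$2(1+T)\,T\,C_\Phi^{\beta'}(T)\,e^{\alpha}=\beta'-\beta_0,\qquad T:=\frac{\beta_0-\beta}{\beta_0},\qquad \beta<\beta_0<\beta',\quad C_\Phi^{\beta'}(T)<\infty. \tag{1}$$ (i) If $\Phi$ is not constant and $C_\Phi^{\beta'}(s)<\infty$ for all $0\le s<(\beta'-\beta)/\beta'$, then (1) has exactly one solution $\beta_0$. (ii) Let $\beta_0$ be a solution of (1), with the corresponding $T$. Then $T>0$. Let $f(t)$ be the solution of the Vlasov equation $$\partial_tf+v\cdot\nabla_xf-\nabla(\Phi\star\rho(t))\cdot\nabla_vf=0,\qquad \rho(t,x)=\int f(t,x,v)\,dv,\qquad f(0)=f^{in}\ \text{a.e.},$$ and, for every $N\ge1$, let $f^N(t)$ be the solution of the $N$-body Liouville equation $$\partial_tf^N+\sum_{k=1}^Nv_k\cdot\nabla_{x_k}f^N-\sum_{k=1}^N\nabla_{x_k}V_N\cdot\nabla_{v_k}f^N=0,\quad V_N(x)=\frac1{2N}\sum_{k,l=1}^N\Phi(x_k-x_l),\quad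 f^N(0)=(f^{in})^{\otimes N}\ \text{a.e.}$$ (solutions: of class $C^1$ in all variables, for $t\in\mathbf R$, and probability densities at each time). Let $f^N_j(t)$ be the $j$-particle marginal of $f^N(t)$, obtained by integrating out the last $N-j$ particles. Then for all $|t|<T$ and all integers $1\le j\le N$ $$\|f^N_j(t)-f(t)^{\otimes j}\|_\beta\le\frac{C(j,|t|/T)}N\,\frac{|t|}T\,\|f^{in}\|_{\beta'}^{\,j},$$ where, for $0\le\tau<1$, $$C(j,\tau)=(1+\gamma(j,\tau))\Big(\frac{j+1}{(1-\tau)^2}+\frac{2\tau}{(1-\tau)^3}\Big)+\frac4{1-\tau},$$ $$\gamma(j,\tau)=\exp\frac{a\,x(a)+x(a)^2}{e^{x(a)}(\log(1/\tau))^2}\ \ (\tau>0),\qquad a=(j+1)\log(1/\tau),\qquad x(a)=1+\tfrac12\big(\sqrt{a^2+4}-a\big),\qquad \gamma(j,0)=1 .$$ In particular $\|f^N_j(t)-f(t)^{\otimes j}\|_\beta\to0$ as $N\to\infty$, uniformly for $t$ in compact subsets of $(-T,T)$ and for the integers $1\le j\le N$ that satisfy (no condition if $t=0$) $$j\le\frac{\log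 N+\log(T/|t|)}{\log\|f^{in}\|_{\beta'}+2\log2+1/(e\log(T/|t|))}.$$ -/

import Mathlib

open MeasureTheory

noncomputable section

/-- The physical space `ℝ^d`, with its Euclidean norm and Lebesgue measure. -/
abbrev PhysSpace (d : ℕ) : Type := EuclideanSpace ℝ (Fin d)

/-- The `n`-particle phase space; a point is `(x, v)` with `x = (x_1, …, x_n)` and
`v = (v_1, …, v_n)`. The measure is Lebesgue measure. -/
abbrev PhaseSpace (d n : ℕ) : Type := (Fin n → PhysSpace d) × (Fin n → PhysSpace d)

/-- `g` is a probability density with respect to Lebesgue measure. -/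
structure IsProbDensity {X : Type*} [MeasureSpace X] (g : X → ℝ) : Prop where
  integrable : Integrable g
  nonneg : ∀ᵐ z, 0 ≤ g z
  integral_eq_one : ∫ z, g z = 1

/-! ### Fourier transforms and analytic norms -/

/-- `Φhat` is the Fourier transform of `Φ`, with the normalization
`Φhat(h) = (2π)^{-d} ∫ Φ(x) e^{-i h·x} dx`, understood in the sense of tempered distributions:
equivalently `Φ(x) = ∫ Φhat(h) e^{i h·x} dh`, without a factor in front of the integral. This does
not require `Φ` to be integrable. -/
structure IsFourierTransform {d : ℕ} (Φ : PhysSpace d → ℝ) (Φhat : PhysSpace d → ℂ) : Prop where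
  integrable : Integrable Φhat
  inversion : ∀ x, (Φ x : ℂ) = ∫ h, Φhat h * Complex.exp (Complex.I * (inner ℝ h x : ℝ))

/-- Symplectic Fourier transform on the one-particle phase space:
`∫ e^{i (x·ξ - v·η)} g(x, v) dx dv`. -/
def symplecticFourierOne {d : ℕ} (g : PhysSpace d × PhysSpace d → ℝ) (ξ η : PhysSpace d) : ℂ :=
  ∫ z : PhysSpace d × PhysSpace d,
    Complex.exp (Complex.I * ((inner ℝ z.1 ξ - inner ℝ z.2 η : ℝ) : ℂ)) * (g z : ℂ)

/-- `‖g‖_ρ = sup_{ξ, η} |g̃(ξ, η)| e^{ρ (|ξ| + |η|)}`, with values in `[0, ∞]`. -/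
def analyticNormOne {d : ℕ} (ρ : ℝ) (g : PhysSpace d × PhysSpace d → ℝ) : ENNReal :=
  ⨆ (ξ : PhysSpace d) (η : PhysSpace d),
    ENNReal.ofReal (‖symplecticFourierOne g ξ η‖ * Real.exp (ρ * (‖ξ‖ + ‖η‖)))

/-- Symplectic Fourier transform on the `n`-particle phase space. -/
def symplecticFourier {d n : ℕ} (g : PhaseSpace d n → ℝ) (ξ η : Fin n → PhysSpace d) : ℂ :=
  ∫ z : PhaseSpace d n,
    Complex.exp (Complex.I *
      ((∑ i, (inner ℝ (z.1 i) (ξ i) - inner ℝ (z.2 i) (η i)) : ℝ) : ℂ)) * (g z : ℂ)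

/-- The analytic norm on the `n`-particle phase space,
`sup_{ξ, η} |g̃(ξ, η)| e^{ρ ∑_i (|ξ_i| + |η_i|)}`, with values in `[0, ∞]`. -/
def analyticNorm {d n : ℕ} (ρ : ℝ) (g : PhaseSpace d n → ℝ) : ENNReal :=
  ⨆ (ξ : Fin n → PhysSpace d) (η : Fin n → PhysSpace d),
    ENNReal.ofReal (‖symplecticFourier g ξ η‖ * Real.exp (ρ * ∑ i, (‖ξ i‖ + ‖η i‖)))

/-! ### Tensor powers and marginals -/

/-- The tensor power `g^{⊗ n}`. -/
def tensorPow {d : ℕ} (n : ℕ) (g : PhysSpace d × PhysSpace d → ℝ) (z : PhaseSpace d n) : ℝ :=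
  ∏ i, g (z.1 i, z.2 i)

/-- `(x_1, …, x_j, y_1, …, y_{N-j})`. -/
def joinParticles {d j N : ℕ} (x : Fin j → PhysSpace d) (y : Fin (N - j) → PhysSpace d) :
    Fin N → PhysSpace d :=
  fun i => if h : i.1 < j then x ⟨i.1, h⟩ else y ⟨i.1 - j, by have := i.2; omega⟩

/-- The `j`-particle marginal (for `j ≤ N`): integrate out the last `N - j` particles. -/
def marginal {d N : ℕ} (j : ℕ) (g : PhaseSpace d N → ℝ) (z : PhaseSpace d j) : ℝ :=
  ∫ w : PhaseSpace d (N - j), g (joinParticles z.1 w.1, joinParticles z.2 w.2)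

/-! ### The Liouville and Vlasov equations -/

/-- `V_N(x) = (1 / 2N) ∑_{k, l} Φ(x_k - x_l)`. -/
def potentialN {d : ℕ} (Φ : PhysSpace d → ℝ) (N : ℕ) (x : Fin N → PhysSpace d) : ℝ :=
  1 / (2 * (N : ℝ)) * ∑ k, ∑ l, Φ (x k - x l)

/-- `∇V_N(x)`, whose `k`-th component is the gradient with respect to `x_k`. -/
def gradPotentialN {d : ℕ} (Φ : PhysSpace d → ℝ) (N : ℕ) (x : Fin N → PhysSpace d) :
    Fin N → PhysSpace d :=
  fun k => gradient (fun y => potentialN Φ N (Function.update x k y)) (x k)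

/-- `f` is a classical solution, in the class of probability densities, of the `N`-body Liouville
equation `∂_t f + v·∇_x f - ∇V_N(x)·∇_v f = 0` with initial datum `f0`. -/
structure IsLiouvilleSolution {d : ℕ} (Φ : PhysSpace d → ℝ) (N : ℕ) (f0 : PhaseSpace d N → ℝ)
    (f : ℝ → PhaseSpace d N → ℝ) : Prop where
  contDiff : ContDiff ℝ 1 (fun p : ℝ × PhaseSpace d N => f p.1 p.2)
  density : ∀ t, IsProbDensity (f t)
  init : f 0 =ᵐ[volume] f0
  equation : ∀ (t : ℝ) (x v : Fin N → PhysSpace d),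
    deriv (fun s => f s (x, v)) t + fderiv ℝ (f t) (x, v) (v, 0)
      - fderiv ℝ (f t) (x, v) (0, gradPotentialN Φ N x) = 0

/-- The spatial density `ρ(x) = ∫ g(x, v) dv`. -/
def spatialDensity {d : ℕ} (g : PhysSpace d × PhysSpace d → ℝ) (x : PhysSpace d) : ℝ :=
  ∫ v, g (x, v)

/-- The mean-field potential `(Φ ⋆ ρ)(x)`, where `ρ` is the spatial density of `g`. -/
def meanFieldPotential {d : ℕ} (Φ : PhysSpace d → ℝ) (g : PhysSpace d × PhysSpace d → ℝ)
    (x : PhysSpace d) : ℝ :=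
  ∫ y, Φ (x - y) * spatialDensity g y

/-- `f` is a classical solution, in the class of probability densities, of the Vlasov equation
`∂_t f + v·∇_x f - ∇(Φ ⋆ ρ(t))(x)·∇_v f = 0` with initial datum `f0`. -/
structure IsVlasovSolution {d : ℕ} (Φ : PhysSpace d → ℝ) (f0 : PhysSpace d × PhysSpace d → ℝ)
    (f : ℝ → PhysSpace d × PhysSpace d → ℝ) : Prop where
  contDiff : ContDiff ℝ 1 (fun p : ℝ × (PhysSpace d × PhysSpace d) => f p.1 p.2)
  density : ∀ t, IsProbDensity (f t)
  init : f 0 =ᵐ[volume] f0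
  equation : ∀ (t : ℝ) (x v : PhysSpace d),
    deriv (fun s => f s (x, v)) t + fderiv ℝ (f t) (x, v) (v, 0)
      - fderiv ℝ (f t) (x, v) (0, gradient (meanFieldPotential Φ (f t)) x) = 0

/-! ### The lifespan and the constants -/

/-- The integrand `|h| |Φhat(h)| e^{2β|h|(1+|t|)}` of `C_Φ^β(t)`. -/
def cPhiIntegrand {d : ℕ} (Φhat : PhysSpace d → ℂ) (β t : ℝ) (h : PhysSpace d) : ℝ :=
  ‖h‖ * ‖Φhat h‖ * Real.exp (2 * β * ‖h‖ * (1 + |t|))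

/-- `C_Φ^β(t) = ∫ |h| |Φhat(h)| e^{2β|h|(1+|t|)} dh`. -/
def cPhi {d : ℕ} (Φhat : PhysSpace d → ℂ) (β t : ℝ) : ℝ :=
  ∫ h, cPhiIntegrand Φhat β t h

/-- `T = (β₀ - β) / β₀`. -/
def lifespan (β β₀ : ℝ) : ℝ := (β₀ - β) / β₀

/-- `β₀` solves `2 (1 + T) T C_Φ^{β'}(T) e^α = β' - β₀` with `T = (β₀ - β) / β₀`,
`β < β₀ < β'` and `C_Φ^{β'}(T) < ∞`. -/
structure IsBetaZero {d : ℕ} (Φhat : PhysSpace d → ℂ) (α β β' β₀ : ℝ) : Prop where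
  lower : β < β₀
  upper : β₀ < β'
  finite : Integrable (cPhiIntegrand Φhat β' (lifespan β β₀))
  equation : 2 * (1 + lifespan β β₀) * lifespan β β₀ * cPhi Φhat β' (lifespan β β₀) * Real.exp α
    = β' - β₀

/-- `x(a) = 1 + (√(a² + 4) - a) / 2`. -/
def xMax (a : ℝ) : ℝ := 1 + (Real.sqrt (a ^ 2 + 4) - a) / 2

/-- `γ(j, τ) = exp ((a x(a) + x(a)²) / (e^{x(a)} (log (1/τ))²))` with `a = (j+1) log (1/τ)`. -/
def gammaConst (j : ℕ) (τ : ℝ) : ℝ :=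
  Real.exp
    (((j + 1) * Real.log (1 / τ) * xMax ((j + 1) * Real.log (1 / τ))
        + xMax ((j + 1) * Real.log (1 / τ)) ^ 2)
      / (Real.exp (xMax ((j + 1) * Real.log (1 / τ))) * Real.log (1 / τ) ^ 2))

/-- `C(j, τ) = (1 + γ(j, τ)) ((j+1)/(1-τ)² + 2τ/(1-τ)³) + 4/(1-τ)`. -/
def vlasovConst (j : ℕ) (τ : ℝ) : ℝ :=
  (1 + gammaConst j τ) * ((j + 1) / (1 - τ) ^ 2 + 2 * τ / (1 - τ) ^ 3) + 4 / (1 - τ)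

end

/-!
Everything takes place on the Fourier side, in the frame of free transport: for a solution `f` of a
transport equation put `g(t; ξ, η) = f̃(t)(ξ, η + tξ)`. A Duhamel formula
(`integral_planeWave_sub_integral_planeWave`) turns the Liouville and Vlasov equations into the
equations `hasDerivAt_movingFourierN` and `hasDerivAt_movingFourierOne`, in which a force of
frequency `h` shifts the frequencies of the two interacting particles by `±h (1, -t)` and produces
the factor `h·(η_k + tξ_k)`, that is, the loss of one derivative.

Let `p = ∑ (|ξ_i| + |η_i|)`. The loss is compensated by measuring a function at time `s` with the
weight `e^{(β' - λ|s|) p}`: since `∫₀ᵗ λ p e^{λ s p} ds ≤ e^{λ t p}`, a right-hand side of size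
`K p` becomes a contraction of size `K / λ`. With `λ = (β' - β₀) / |t|` the width of analyticity at time
`t` is `β₀`, and the equation for `β₀` says precisely that `4 M K = λ |t| / T`. The solutions are
not known beforehand to be analytic at positive times; this is circumvented by truncating the
exponent at time `0` to `min (β' p) R`. The weight is still `β'`-Lipschitz in `p`, every bounded
function has a finite norm, the contraction gives a bound independent of `R`, and `R` is arbitrary
(`le_mul_of_forall_halving`, `norm_le_of_vlasov_fourier`). Neither existence nor uniqueness theory
for the two equations is needed.

The `N`-body density is compared directly with the `N`-th tensor power of the Vlasov solution, at
frequencies that vanish for all but `J` *active* particles. Only active particles feel a force. If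
`k` is active and `l` is not, then the interaction of `k` and `l` in the tensor power is exactly the
mean-field interaction, because the transform of a probability density is `1` at the origin
(`prod_exchange_eq_meanFieldTerm`). Hence the source of the error is only due to the pairs of active
particles, a proportion `J / N`, and the contraction for the norm with weight `(J + 1)⁻¹ M^{-J}`
yields the error bound `(|t| / T) (J + 1) M^J / N` (`norm_sub_prod_le`). The transform of the `j`-th
marginal is the `N`-body transform with the last `N - j` frequencies equal to zero, so that `J ≤ j`;
this gives the estimate with the constant `j + 1`, which is at most `C(j, |t| / T)`.

The existence and uniqueness of `β₀` follow from the intermediate value theorem and monotonicity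
(`existsUnique_isBetaZero`).
-/

set_option linter.unusedSectionVars false

/-! ### Plane waves transported by the free flow -/

section PlaneWave

variable {V : Type*} [NormedAddCommGroup V] [NormedSpace ℝ V]

/-- The free-transport plane wave `e^{i(ℓ(x) - (m + tℓ)(v))}`; as a function of `(t, x, v)` it
solves `∂_t φ + v·∇_x φ = 0`. -/
noncomputable def planeWave (ℓ m : V →L[ℝ] ℝ) (t : ℝ) (z : V × V) : ℂ :=
  Complex.exp (Complex.I * ((ℓ z.1 - (m z.2 + t * ℓ z.2) : ℝ) : ℂ))

lemma norm_planeWave (ℓ m : V →L[ℝ] ℝ) (t : ℝ) (z : V × V) : ‖planeWave ℓ m t z‖ = 1 := by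
  rw [planeWave, mul_comm, Complex.norm_exp_ofReal_mul_I]

lemma contDiff_planeWave (ℓ m : V →L[ℝ] ℝ) :
    ContDiff ℝ 1 fun p : ℝ × (V × V) => planeWave ℓ m p.1 p.2 := by
  unfold planeWave
  refine ContDiff.cexp (contDiff_const.mul ?_)
  have h : ContDiff ℝ 1 fun p : ℝ × (V × V) => ℓ p.2.1 - (m p.2.2 + p.1 * ℓ p.2.2) :=
    (by fun_prop : ContDiff ℝ 1 fun p : ℝ × (V × V) => ℓ p.2.1).sub (by fun_prop)
  exact Complex.ofRealCLM.contDiff.comp h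

lemma fderiv_planeWave (ℓ m : V →L[ℝ] ℝ) (s : ℝ) (z : V × V) (a : V) :
    fderiv ℝ (fun p : ℝ × (V × V) => planeWave ℓ m p.1 p.2) (s, z) (1, (z.2, -a))
      = Complex.I * (((m + s • ℓ) a : ℝ) : ℂ) * planeWave ℓ m s z := by
  -- differentiate along the line through `(s, z)` with direction `(1, v, -a)`
  have hd : DifferentiableAt ℝ (fun p : ℝ × (V × V) => planeWave ℓ m p.1 p.2) (s, z) :=
    ((contDiff_planeWave ℓ m).differentiable one_ne_zero) _
  have h1 : HasDerivAt (fun r : ℝ => (s + r, (z.1 + r • z.2, z.2 + r • -a)))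
      ((1 : ℝ), (z.2, -a)) 0 := by
    have e1 : HasDerivAt (fun r : ℝ => s + r) 1 0 := (hasDerivAt_id 0).const_add s
    have e2 : HasDerivAt (fun r : ℝ => z.1 + r • z.2) z.2 0 := by
      simpa using ((hasDerivAt_id (0 : ℝ)).smul_const z.2).const_add z.1
    have e3 : HasDerivAt (fun r : ℝ => z.2 + r • -a) (-a) 0 := by
      simpa using ((hasDerivAt_id (0 : ℝ)).smul_const (-a)).const_add z.2
    exact e1.prodMk (e2.prodMk e3)
  have h2 := HasFDerivAt.comp_hasDerivAt_of_eq (0 : ℝ) hd.hasFDerivAt h1 (by simp)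
  have hr : HasDerivAt (fun r : ℝ => ℓ (z.1 + r • z.2)
      - (m (z.2 + r • -a) + (s + r) * ℓ (z.2 + r • -a))) (m a + s * ℓ a) 0 := by
    have e : (fun r : ℝ => ℓ (z.1 + r • z.2) - (m (z.2 + r • -a) + (s + r) * ℓ (z.2 + r • -a)))
        = fun r : ℝ => (ℓ z.1 - m z.2 - s * ℓ z.2) + r * (m a + s * ℓ a) + r ^ 2 * ℓ a := by
      funext r; simp; ring
    rw [e]
    have e4 : HasDerivAt (fun r : ℝ => (ℓ z.1 - m z.2 - s * ℓ z.2) + r * (m a + s * ℓ a))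
        (1 * (m a + s * ℓ a)) 0 := ((hasDerivAt_id (0 : ℝ)).mul_const _).const_add _
    have e5 : HasDerivAt (fun r : ℝ => r ^ 2 * ℓ a) (((2 : ℕ) : ℝ) * 0 ^ (2 - 1) * ℓ a) 0 :=
      (hasDerivAt_pow 2 (0 : ℝ)).mul_const _
    have e6 := e4.add e5
    simp only [one_mul, Nat.cast_ofNat, Nat.add_one_sub_one, pow_one, mul_zero, zero_mul,
      add_zero] at e6
    exact e6
  have h3 := ((hr.ofReal_comp).const_mul Complex.I).cexp
  have h4 := h2.unique h3
  rw [h4]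
  simp [planeWave]
  ring

end PlaneWave

/-! ### Duhamel formula for transport equations -/

section Transport

variable {V : Type*} [NormedAddCommGroup V] [NormedSpace ℝ V] [FiniteDimensional ℝ V]
  [MeasureSpace V] [BorelSpace V] [(volume : Measure V).IsAddHaarMeasure]

lemma integral_fderiv_apply_eq_zero {u : V → ℂ} (hu : ContDiff ℝ 1 u) (hc : HasCompactSupport u)
    (w : V) : ∫ x, fderiv ℝ u x w = 0 := by
  have hcont : Continuous fun x => fderiv ℝ u x w :=
    (hu.continuous_fderiv one_ne_zero).clm_apply continuous_const
  have hcs : HasCompactSupport fun x => fderiv ℝ u x w := by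
    simpa using hc.fderiv_apply (𝕜 := ℝ) w
  have h := integral_bilinear_fderiv_right_eq_neg_left_of_integrable (μ := (volume : Measure V))
    (f := fun _ : V => (1 : ℂ)) (g := u) (v := w) (B := ContinuousLinearMap.mul ℝ ℂ)
    (by simp) (by simpa using hcont.integrable_of_hasCompactSupport hcs)
    (by simpa using hu.continuous.integrable_of_hasCompactSupport hc)
    (fun x _ => by fun_prop) (fun x _ => (hu.differentiable one_ne_zero).differentiableAt)
  simpa using h

lemma integrable_fderiv_apply {X : Type*} [NormedAddCommGroup X] [NormedSpace ℝ X]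
    [MeasureSpace X] [OpensMeasurableSpace X] [IsFiniteMeasureOnCompacts (volume : Measure X)]
    {w : X → ℂ} (hw : ContDiff ℝ 1 w)
    (hc : HasCompactSupport w) {b : X → X} (hb : Continuous b) :
    Integrable fun z => fderiv ℝ w z (b z) := by
  refine ((hw.continuous_fderiv one_ne_zero).clm_apply hb).integrable_of_hasCompactSupport ?_
  refine (hc.fderiv (𝕜 := ℝ)).mono fun z hz => ?_
  intro h0; apply hz; simp [h0]

lemma integral_fderiv_fst_eq_zero {w : V × V → ℂ} (hw : ContDiff ℝ 1 w)
    (hc : HasCompactSupport w) {b : V → V} (hb : Continuous b) :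
    ∫ z, fderiv ℝ w z (b z.2, 0) = 0 := by
  have hint := integrable_fderiv_apply hw hc (b := fun z => (b z.2, 0)) (by fun_prop)
  rw [Measure.volume_eq_prod] at hint ⊢
  rw [integral_prod_symm _ hint]
  have : ∀ y : V, ∫ x, fderiv ℝ w (x, y) (b y, 0) = 0 := fun y => by
    have hwy : ContDiff ℝ 1 fun x => w (x, y) := hw.comp (contDiff_id.prodMk contDiff_const)
    have hcy : HasCompactSupport fun x => w (x, y) := by
      refine HasCompactSupport.of_support_subset_isCompact (hc.image continuous_fst)
        fun x hx => ⟨(x, y), subset_tsupport _ hx, rfl⟩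
    rw [← integral_fderiv_apply_eq_zero hwy hcy (b y)]
    refine integral_congr_ae (Filter.Eventually.of_forall fun x => ?_)
    have h1 : HasFDerivAt (fun x : V => (x, y)) (ContinuousLinearMap.inl ℝ V V) x :=
      hasFDerivAt_prodMk_left x y
    have h2 := ((hw.differentiable one_ne_zero) (x, y)).hasFDerivAt.comp x h1
    have h3 := h2.fderiv
    simp only [Function.comp_def] at h3
    simp [h3]
  simp [this]

lemma integral_fderiv_snd_eq_zero {w : V × V → ℂ} (hw : ContDiff ℝ 1 w)
    (hc : HasCompactSupport w) {b : V → V} (hb : Continuous b) :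
    ∫ z, fderiv ℝ w z (0, b z.1) = 0 := by
  have hint := integrable_fderiv_apply hw hc (b := fun z => (0, b z.1)) (by fun_prop)
  rw [Measure.volume_eq_prod] at hint ⊢
  rw [integral_prod _ hint]
  have : ∀ y : V, ∫ x, fderiv ℝ w (y, x) (0, b y) = 0 := fun y => by
    have hwy : ContDiff ℝ 1 fun x => w (y, x) := hw.comp (contDiff_const.prodMk contDiff_id)
    have hcy : HasCompactSupport fun x => w (y, x) := by
      refine HasCompactSupport.of_support_subset_isCompact (hc.image continuous_snd)
        fun x hx => ⟨(y, x), subset_tsupport _ hx, rfl⟩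
    rw [← integral_fderiv_apply_eq_zero hwy hcy (b y)]
    refine integral_congr_ae (Filter.Eventually.of_forall fun x => ?_)
    have h1 : HasFDerivAt (fun x : V => (y, x)) (ContinuousLinearMap.inr ℝ V V) x :=
      hasFDerivAt_prodMk_right y x
    have h2 := ((hw.differentiable one_ne_zero) (y, x)).hasFDerivAt.comp x h1
    have h3 := h2.fderiv
    simp only [Function.comp_def] at h3
    simp [h3]
  simp [this]

/-- Fundamental theorem of calculus in time, integrated over a phase space. -/
lemma integral_sub_integral_eq_intervalIntegral {X : Type*} [NormedAddCommGroup X]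
    [NormedSpace ℝ X] [MeasureSpace X] [BorelSpace X] [SecondCountableTopology X]
    [SFinite (volume : Measure X)]
    [IsFiniteMeasureOnCompacts (volume : Measure X)] {U : ℝ × X → ℂ} (hU : ContDiff ℝ 1 U)
    {K : Set X} (hK : IsCompact K) (hUK : ∀ s, ∀ z ∉ K, U (s, z) = 0)
    (hDUK : ∀ s, ∀ z ∉ K, fderiv ℝ U (s, z) = 0) (t₁ t₂ : ℝ) :
    (∫ z, U (t₂, z)) - ∫ z, U (t₁, z) = ∫ s in t₁..t₂, ∫ z, fderiv ℝ U (s, z) (1, 0) := by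
  have hcont : Continuous fun p => fderiv ℝ U p (1, 0) :=
    (hU.continuous_fderiv one_ne_zero).clm_apply continuous_const
  have hint : ∀ s, Integrable fun z => U (s, z) := fun s =>
    (hU.continuous.comp (by fun_prop : Continuous fun z : X => (s, z))).integrable_of_hasCompactSupport
      (HasCompactSupport.intro hK (hUK s))
  have hFTC : ∀ z, U (t₂, z) - U (t₁, z) = ∫ s in t₁..t₂, fderiv ℝ U (s, z) (1, 0) := fun z => by
    refine (intervalIntegral.integral_eq_sub_of_hasDerivAt (f := fun s => U (s, z))
      (fun s _ => ?_) ?_).symm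
    · have h1 : HasDerivAt (fun s : ℝ => (s, z)) ((1 : ℝ), (0 : X)) s :=
        (hasDerivAt_id s).prodMk (hasDerivAt_const s z)
      exact ((hU.differentiable one_ne_zero) (s, z)).hasFDerivAt.comp_hasDerivAt s h1
    · exact (hcont.comp (by fun_prop : Continuous fun s : ℝ => (s, z))).intervalIntegrable _ _
  rw [← integral_sub (hint _) (hint _)]
  simp_rw [hFTC]
  refine (intervalIntegral_integral_swap ?_).symm
  have h1 : IntegrableOn (fun p => fderiv ℝ U p (1, 0)) (Set.uIcc t₁ t₂ ×ˢ K)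
      ((volume : Measure ℝ).prod (volume : Measure X)) :=
    hcont.continuousOn.integrableOn_compact (isCompact_uIcc.prod hK)
  have h2 : IntegrableOn (fun p => fderiv ℝ U p (1, 0)) (Set.uIcc t₁ t₂ ×ˢ Set.univ)
      ((volume : Measure ℝ).prod (volume : Measure X)) := by
    refine h1.of_forall_sdiff_eq_zero (measurableSet_uIcc.prod MeasurableSet.univ) ?_
    rintro ⟨s, z⟩ ⟨hz, hz'⟩
    have : z ∉ K := fun h => hz' ⟨hz.1, h⟩
    simp [hDUK s z this]
  have h3 := h2.mono_set
    (Set.prod_mono_left (t := Set.univ) (Set.uIoc_subset_uIcc (a := t₁) (b := t₂)))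
  rw [IntegrableOn, ← Measure.prod_restrict, Measure.restrict_univ] at h3
  exact h3

/-- Weak form of the transport equation for a compactly supported cutoff `χ`. Along the direction
`(1, v, -a)` the derivative of `f` vanishes and that of the plane wave is explicit, while the `x`-
and `v`-parts of this directional derivative integrate to zero over the phase space. -/
lemma integral_cutoff_sub_integral_cutoff {f : ℝ → V × V → ℝ} {a : ℝ → V → V}
    (hf : ContDiff ℝ 1 fun p : ℝ × (V × V) => f p.1 p.2) (ha : ∀ t, Continuous (a t))
    (heq : ∀ t x v, deriv (fun s => f s (x, v)) t + fderiv ℝ (f t) (x, v) (v, 0)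
      - fderiv ℝ (f t) (x, v) (0, a t x) = 0)
    {χ : V × V → ℝ} (hχ : ContDiff ℝ 1 χ) (hχc : HasCompactSupport χ) (ℓ m : V →L[ℝ] ℝ) :
    ∃ D : ℝ → ℂ, Continuous D ∧
      (∀ s, D s = ∫ z, ((f s z * fderiv ℝ χ z (z.2, -a s z.1) : ℝ) : ℂ) * planeWave ℓ m s z
        + (χ z * f s z : ℝ) * (Complex.I * (((m + s • ℓ) (a s z.1) : ℝ) : ℂ)
          * planeWave ℓ m s z)) ∧
      ∀ t₁ t₂, (∫ z, ((χ z * f t₂ z : ℝ) : ℂ) * planeWave ℓ m t₂ z)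
        - (∫ z, ((χ z * f t₁ z : ℝ) : ℂ) * planeWave ℓ m t₁ z) = ∫ s in t₁..t₂, D s := by
  set c : ℝ × (V × V) → ℝ := fun p => χ p.2 * f p.1 p.2 with hc
  set φ : ℝ × (V × V) → ℂ := fun p => planeWave ℓ m p.1 p.2 with hφ
  set U : ℝ × (V × V) → ℂ := fun p => c p • φ p with hU
  have hcC : ContDiff ℝ 1 c := (hχ.comp contDiff_snd).mul hf
  have hφC : ContDiff ℝ 1 φ := contDiff_planeWave ℓ m
  have hUC : ContDiff ℝ 1 U := hcC.smul hφC
  have hK : IsCompact (tsupport χ) := hχc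
  have hUK : ∀ s, ∀ z ∉ tsupport χ, U (s, z) = 0 := fun s z hz => by
    simp [hU, hc, image_eq_zero_of_notMem_tsupport hz]
  have hDUK : ∀ s, ∀ z ∉ tsupport χ, fderiv ℝ U (s, z) = 0 := fun s z hz => by
    have hev : U =ᶠ[nhds (s, z)] fun _ => 0 := by
      have : (Set.univ ×ˢ (tsupport χ)ᶜ : Set (ℝ × (V × V))) ∈ nhds (s, z) :=
        (isOpen_univ.prod (isClosed_tsupport χ).isOpen_compl).mem_nhds ⟨trivial, hz⟩
      filter_upwards [this] with p hp using hUK p.1 p.2 hp.2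
    rw [hev.fderiv_eq]; simp
  have hDcont : Continuous fun p => fderiv ℝ U p (1, 0) :=
    (hUC.continuous_fderiv one_ne_zero).clm_apply continuous_const
  refine ⟨fun s => ∫ z, fderiv ℝ U (s, z) (1, 0), ?_, fun s => ?_, fun t₁ t₂ => ?_⟩
  · have h := continuous_parametric_integral_of_continuous (μ := (volume : Measure (V × V)))
      (f := fun (s : ℝ) z => fderiv ℝ U (s, z) (1, 0)) (by exact hDcont) hK
    convert h using 2 with s
    refine (setIntegral_eq_integral_of_forall_compl_eq_zero fun z hz => ?_).symm
    simp [hDUK s z hz]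
  · -- `W` is the time slice of `U`
    set W : V × V → ℂ := fun z => U (s, z) with hW
    have hWC : ContDiff ℝ 1 W := hUC.comp (contDiff_const.prodMk contDiff_id)
    have hWc : HasCompactSupport W := HasCompactSupport.intro hK (hUK s)
    have hWd : ∀ z w, fderiv ℝ W z w = fderiv ℝ U (s, z) (0, w) := fun z w => by
      have h2 := ((hUC.differentiable one_ne_zero) (s, z)).hasFDerivAt.comp z
        (hasFDerivAt_prodMk_right s z)
      have h3 := h2.fderiv
      simp only [Function.comp_def] at h3
      simp [hW, h3]
    have i1 := integrable_fderiv_apply hWC hWc (b := fun z => (z.2, 0)) (by fun_prop)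
    have i2 := integrable_fderiv_apply hWC hWc (b := fun z => (0, a s z.1))
      (by have := ha s; fun_prop)
    have i3 : Integrable fun z => fderiv ℝ U (s, z) (1, 0) :=
      (hDcont.comp
        (by fun_prop : Continuous fun z : V × V => (s, z))).integrable_of_hasCompactSupport
        (HasCompactSupport.intro hK fun z hz => by simp [hDUK s z hz])
    have z1 : ∫ z, fderiv ℝ W z (z.2, 0) = 0 := integral_fderiv_fst_eq_zero hWC hWc continuous_id
    have z2 : ∫ z, fderiv ℝ W z (0, a s z.1) = 0 := integral_fderiv_snd_eq_zero hWC hWc (ha s)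
    have key : ∀ z : V × V, ((f s z * fderiv ℝ χ z (z.2, -a s z.1) : ℝ) : ℂ) * planeWave ℓ m s z
        + (χ z * f s z : ℝ) * (Complex.I * (((m + s • ℓ) (a s z.1) : ℝ) : ℂ)
          * planeWave ℓ m s z)
        = fderiv ℝ U (s, z) (1, 0) + fderiv ℝ W z (z.2, 0) - fderiv ℝ W z (0, a s z.1) := by
      intro z
      have e1 : fderiv ℝ U (s, z) (1, 0) + fderiv ℝ W z (z.2, 0) - fderiv ℝ W z (0, a s z.1)
          = fderiv ℝ U (s, z) (1, (z.2, -a s z.1)) := by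
        rw [hWd, hWd, ← map_add, ← map_sub]; simp
      have e2 : fderiv ℝ c (s, z) (1, (z.2, -a s z.1)) = f s z * fderiv ℝ χ z (z.2, -a s z.1) := by
        have hfd : DifferentiableAt ℝ (fun p : ℝ × (V × V) => f p.1 p.2) (s, z) :=
          (hf.differentiable one_ne_zero) _
        have hχd : HasFDerivAt (fun p : ℝ × (V × V) => χ p.2)
            ((fderiv ℝ χ z).comp (ContinuousLinearMap.snd ℝ ℝ (V × V))) (s, z) :=
          ((hχ.differentiable one_ne_zero) z).hasFDerivAt.comp (s, z) hasFDerivAt_snd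
        have h0 : fderiv ℝ (fun p : ℝ × (V × V) => f p.1 p.2) (s, z) (1, (z.2, -a s z.1)) = 0 := by
          have d1 : deriv (fun r => f r z) s
              = fderiv ℝ (fun p : ℝ × (V × V) => f p.1 p.2) (s, z) (1, 0) :=
            (HasFDerivAt.comp_hasDerivAt (f := fun r : ℝ => (r, z)) s hfd.hasFDerivAt
              ((hasDerivAt_id s).prodMk (hasDerivAt_const s z))).deriv
          have d2 : ∀ w, fderiv ℝ (f s) z w
              = fderiv ℝ (fun p : ℝ × (V × V) => f p.1 p.2) (s, z) (0, w) := fun w => by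
            have h3 := (hfd.hasFDerivAt.comp z (hasFDerivAt_prodMk_right s z)).fderiv
            simp only [Function.comp_def] at h3
            simp [h3]
          have h4 := heq s z.1 z.2
          rw [show (z.1, z.2) = z from rfl, d1, d2, d2, ← map_add, ← map_sub] at h4
          simpa using h4
        have h5 := (hχd.mul hfd.hasFDerivAt).fderiv
        rw [show c = (fun p : ℝ × (V × V) => χ p.2) * fun p => f p.1 p.2 from rfl, h5]
        simp [h0]
      rw [e1, hU, fderiv_fun_smul ((hcC.differentiable one_ne_zero) _)
        ((hφC.differentiable one_ne_zero) _)]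
      simp only [add_apply, smul_apply,
        ContinuousLinearMap.smulRight_apply, e2, hφ, fderiv_planeWave]
      simp [hc, Complex.real_smul]
      ring
    simp_rw [key]
    rw [integral_sub (by exact i3.add i1) (by exact i2), integral_add i3 i1, z1, z2]
    simp
  · have := integral_sub_integral_eq_intervalIntegral hUC hK hUK hDUK t₁ t₂
    simpa [hU, hc, hφ, Complex.real_smul] using this

open Filter Topology in
/-- Duhamel formula for the Fourier transform, in the frame of free transport, of an integrable
classical solution of a transport equation with bounded force: no decay of the derivatives of the
solution is needed. -/
theorem integral_planeWave_sub_integral_planeWave {f : ℝ → V × V → ℝ} {a : ℝ → V → V}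
    (hf : ContDiff ℝ 1 fun p : ℝ × (V × V) => f p.1 p.2) (ha : ∀ t, Continuous (a t))
    {B : ℝ} (hB : ∀ t x, ‖a t x‖ ≤ B)
    (heq : ∀ t x v, deriv (fun s => f s (x, v)) t + fderiv ℝ (f t) (x, v) (v, 0)
      - fderiv ℝ (f t) (x, v) (0, a t x) = 0)
    (hint : ∀ t, Integrable (f t)) (hmass : ∀ t, ∫ z, ‖f t z‖ ≤ 1) (ℓ m : V →L[ℝ] ℝ)
    (t₁ t₂ : ℝ) :
    (∫ z, (f t₂ z : ℂ) * planeWave ℓ m t₂ z) - (∫ z, (f t₁ z : ℂ) * planeWave ℓ m t₁ z)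
      = ∫ s in t₁..t₂, ∫ z, (f s z : ℂ) * (Complex.I * (((m + s • ℓ) (a s z.1) : ℝ) : ℂ)
          * planeWave ℓ m s z) := by
  have hB0 : 0 ≤ B := (norm_nonneg _).trans (hB 0 0)
  let χ : ContDiffBump (0 : V × V) := ⟨1, 2, one_pos, one_lt_two⟩
  have hχC : ContDiff ℝ 1 χ := χ.contDiff
  obtain ⟨C, hC⟩ := (hχC.continuous_fderiv one_ne_zero).bounded_above_of_compact_support
    (χ.hasCompactSupport.fderiv (𝕜 := ℝ))
  have hC0 : 0 ≤ C := (norm_nonneg _).trans (hC 0)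
  -- the cutoff at radius `n + 1`
  set r : ℕ → ℝ := fun n => ((n : ℝ) + 1)⁻¹ with hr
  have hr0 : ∀ n, 0 < r n := fun n => by positivity
  have hr1 : ∀ n, r n ≤ 1 := fun n => inv_le_one_of_one_le₀ (by simp)
  have hrt : Tendsto r atTop (𝓝 0) := by
    simpa [hr, one_div] using tendsto_one_div_add_atTop_nhds_zero_nat (𝕜 := ℝ)
  set η : ℕ → V × V → ℝ := fun n z => χ (r n • z) with hη
  have hηC : ∀ n, ContDiff ℝ 1 (η n) := fun n => hχC.comp (contDiff_const_smul _)
  have hηc : ∀ n, HasCompactSupport (η n) := fun n =>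
    χ.hasCompactSupport.comp_homeomorph (Homeomorph.smulOfNeZero (r n) (hr0 n).ne')
  have hη1 : ∀ n z, |η n z| ≤ 1 := fun n z => by
    rw [abs_of_nonneg χ.nonneg]; exact χ.le_one
  have hηt : ∀ z, Tendsto (fun n => η n z) atTop (𝓝 1) := fun z => by
    have h1 : Tendsto (fun n => r n • z) atTop (𝓝 0) := by simpa using hrt.smul_const z
    have h2 := (hχC.continuous.tendsto 0).comp h1
    rwa [χ.one_of_mem_closedBall (by simp [χ])] at h2
  have hηd : ∀ n z w, fderiv ℝ (η n) z w = r n * fderiv ℝ χ (r n • z) w := fun n z w => by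
    have h1 : HasFDerivAt (fun z : V × V => r n • z) (r n • ContinuousLinearMap.id ℝ (V × V)) z :=
      (hasFDerivAt_id z).const_smul (r n)
    have h2 := (((hχC.differentiable one_ne_zero) (r n • z)).hasFDerivAt.comp z h1).fderiv
    simp only [Function.comp_def] at h2
    simp [hη, h2]
  have hdir : ∀ s (z : V × V), ‖((z.2, -a s z.1) : V × V)‖ ≤ ‖z‖ + B := fun s z => by
    refine max_le ((norm_snd_le z).trans (by linarith)) ?_
    simpa using (hB s z.1).trans (by linarith [norm_nonneg z])
  have hηd1 : ∀ n s z, |fderiv ℝ (η n) z (z.2, -a s z.1)| ≤ r n * (C * (‖z‖ + B)) :=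
    fun n s z => by
      rw [hηd, abs_mul, abs_of_pos (hr0 n)]
      refine mul_le_mul_of_nonneg_left ?_ (hr0 n).le
      rw [← Real.norm_eq_abs]
      exact (ContinuousLinearMap.le_opNorm _ _).trans
        (mul_le_mul (hC _) (hdir s z) (norm_nonneg _) hC0)
  have hηd2 : ∀ n s z, |fderiv ℝ (η n) z (z.2, -a s z.1)| ≤ C * (2 + B) := fun n s z => by
    by_cases hz : ‖r n • z‖ ≤ 2
    · refine (hηd1 n s z).trans ?_
      rw [norm_smul, Real.norm_of_nonneg (hr0 n).le] at hz
      have : r n * B ≤ B := mul_le_of_le_one_left hB0 (hr1 n)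
      calc r n * (C * (‖z‖ + B)) = C * (r n * ‖z‖ + r n * B) := by ring
        _ ≤ _ := by gcongr
    · have h0 : fderiv ℝ χ (r n • z) = 0 := by
        by_contra h
        have h1 := support_fderiv_subset ℝ (f := χ) h
        rw [χ.tsupport_eq] at h1
        exact hz (by simpa [χ] using h1)
      rw [hηd, h0]; simp; positivity
  choose D hDc hDeq hDint using fun n =>
    integral_cutoff_sub_integral_cutoff hf ha heq (hηC n) (hηc n) ℓ m
  have hfc : ∀ s, Continuous (f s) := fun s =>
    hf.continuous.comp (by fun_prop : Continuous fun z : V × V => (s, z))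
  have hφc : ∀ s, Continuous (planeWave ℓ m s) := fun s =>
    (contDiff_planeWave ℓ m).continuous.comp (by fun_prop : Continuous fun z : V × V => (s, z))
  -- convergence of both sides as the cutoff is removed
  have hleft : ∀ t, Tendsto (fun n => ∫ z, ((η n z * f t z : ℝ) : ℂ) * planeWave ℓ m t z) atTop
      (𝓝 (∫ z, (f t z : ℂ) * planeWave ℓ m t z)) := fun t => by
    refine tendsto_integral_of_dominated_convergence (fun z => ‖f t z‖) (fun n => ?_)
      (hint t).norm (fun n => Eventually.of_forall fun z => ?_)
      (Eventually.of_forall fun z => ?_)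
    · have := (hηC n).continuous
      have := hfc t
      have := hφc t
      exact Continuous.aestronglyMeasurable (by fun_prop)
    · rw [norm_mul, norm_planeWave, mul_one, Complex.norm_real, norm_mul]
      exact mul_le_of_le_one_left (norm_nonneg _) (hη1 n z)
    · refine Tendsto.mul_const _ ?_
      have := (hηt z).mul_const (f t z)
      rw [one_mul] at this
      exact (Complex.continuous_ofReal.tendsto _).comp this
  have hL : ∀ s x, |(m + s • ℓ) (a s x)| ≤ ‖m + s • ℓ‖ * B := fun s x => by
    rw [← Real.norm_eq_abs]
    exact (ContinuousLinearMap.le_opNorm _ _).trans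
      (mul_le_mul_of_nonneg_left (hB s x) (norm_nonneg _))
  have hptw : ∀ n s z, ‖((f s z * fderiv ℝ (η n) z (z.2, -a s z.1) : ℝ) : ℂ) * planeWave ℓ m s z
        + (η n z * f s z : ℝ) * (Complex.I * (((m + s • ℓ) (a s z.1) : ℝ) : ℂ)
          * planeWave ℓ m s z)‖ ≤ ‖f s z‖ * (C * (2 + B) + ‖m + s • ℓ‖ * B) := fun n s z => by
    refine (norm_add_le _ _).trans ?_
    rw [mul_add]
    refine add_le_add ?_ ?_
    · rw [norm_mul, norm_planeWave, mul_one, Complex.norm_real, norm_mul]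
      exact mul_le_mul_of_nonneg_left (hηd2 n s z) (norm_nonneg _)
    · rw [norm_mul, norm_mul, norm_mul, norm_planeWave, Complex.norm_I, Complex.norm_real,
        Complex.norm_real, norm_mul, one_mul, mul_one]
      refine mul_le_mul ?_ (hL s z.1) (norm_nonneg _) (norm_nonneg _)
      exact mul_le_of_le_one_left (norm_nonneg _) (hη1 n z)
  have hDt : ∀ s, Tendsto (fun n => D n s) atTop
      (𝓝 (∫ z, (f s z : ℂ) * (Complex.I * (((m + s • ℓ) (a s z.1) : ℝ) : ℂ)
          * planeWave ℓ m s z))) := fun s => by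
    simp_rw [hDeq]
    refine tendsto_integral_of_dominated_convergence
      (fun z => ‖f s z‖ * (C * (2 + B) + ‖m + s • ℓ‖ * B)) (fun n => ?_)
      ((hint s).norm.mul_const _) (fun n => Eventually.of_forall fun z => hptw n s z)
      (Eventually.of_forall fun z => ?_)
    · have h1 := (hηC n).continuous
      have h2 := hfc s
      have h3 := hφc s
      have h4 := ha s
      have h5 : Continuous fun z : V × V => fderiv ℝ (η n) z (z.2, -a s z.1) :=
        ((hηC n).continuous_fderiv one_ne_zero).clm_apply (by fun_prop)
      exact Continuous.aestronglyMeasurable (by fun_prop)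
    · have h1 : Tendsto (fun n => fderiv ℝ (η n) z (z.2, -a s z.1)) atTop (𝓝 0) := by
        refine squeeze_zero_norm (fun n => hηd1 n s z) ?_
        simpa using hrt.mul_const (C * (‖z‖ + B))
      have h2 := (hηt z).mul_const (f s z)
      have h3 := (((Complex.continuous_ofReal.tendsto _).comp
        (h1.const_mul (f s z))).mul_const (planeWave ℓ m s z)).add
        (((Complex.continuous_ofReal.tendsto _).comp h2).mul_const
          (Complex.I * (((m + s • ℓ) (a s z.1) : ℝ) : ℂ) * planeWave ℓ m s z))
      simpa using h3
  have hDb : ∀ n s, ‖D n s‖ ≤ C * (2 + B) + ‖m + s • ℓ‖ * B := fun n s => by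
    rw [hDeq]
    have h1 := norm_integral_le_of_norm_le ((hint s).norm.mul_const (C * (2 + B) + ‖m + s • ℓ‖ * B))
      (Eventually.of_forall fun z => hptw n s z)
    refine h1.trans ?_
    rw [integral_mul_const]
    exact mul_le_of_le_one_left (by positivity) (hmass s)
  have hright : Tendsto (fun n => ∫ s in t₁..t₂, D n s) atTop
      (𝓝 (∫ s in t₁..t₂, ∫ z, (f s z : ℂ) * (Complex.I * (((m + s • ℓ) (a s z.1) : ℝ) : ℂ)
          * planeWave ℓ m s z))) := by
    refine intervalIntegral.tendsto_integral_filter_of_dominated_convergence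
      (fun s => C * (2 + B) + ‖m + s • ℓ‖ * B)
      (Eventually.of_forall fun n => (hDc n).aestronglyMeasurable)
      (Eventually.of_forall fun n => Eventually.of_forall fun s _ => hDb n s) ?_
      (Eventually.of_forall fun s _ => hDt s)
    exact Continuous.intervalIntegrable (by fun_prop) _ _
  refine tendsto_nhds_unique ((hleft t₂).sub (hleft t₁)) ?_
  exact hright.congr fun n => (hDint n t₁ t₂).symm

end Transport

/-! ### Convergence of probability densities -/

section ProbDensity

open Filter Topology

lemma IsProbDensity.integral_norm {X : Type*} [MeasureSpace X] {g : X → ℝ} (hg : IsProbDensity g) :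
    ∫ z, ‖g z‖ = 1 := by
  rw [← hg.integral_eq_one]
  exact integral_congr_ae (hg.nonneg.mono fun z hz => Real.norm_of_nonneg hz)

/-- Scheffé's lemma: probability densities that converge pointwise converge in `L¹`. -/
lemma tendsto_integral_norm_sub_of_isProbDensity {X ι : Type*} [MeasureSpace X] {l : Filter ι}
    [l.IsCountablyGenerated] {g : ι → X → ℝ} {g₀ : X → ℝ} (hg : ∀ i, IsProbDensity (g i))
    (hg₀ : IsProbDensity g₀) (h : ∀ z, Tendsto (fun i => g i z) l (𝓝 (g₀ z))) :
    Tendsto (fun i => ∫ z, ‖g i z - g₀ z‖) l (𝓝 0) := by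
  -- `|a - b| = 2 (b - a)⁺ + (a - b)`, and the last term has integral zero
  have h1 : ∀ i, ∫ z, ‖g i z - g₀ z‖ = 2 * ∫ z, max (g₀ z - g i z) 0 := fun i => by
    have e : ∀ z, ‖g i z - g₀ z‖ = 2 * max (g₀ z - g i z) 0 + (g i z - g₀ z) := fun z => by
      rcases le_total (g₀ z) (g i z) with h | h
      · rw [Real.norm_of_nonneg (by linarith), max_eq_right (by linarith)]; ring
      · rw [Real.norm_of_nonpos (by linarith), max_eq_left (by linarith)]; ring
    simp_rw [e]
    have i1 : Integrable fun z => max (g₀ z - g i z) 0 :=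
      (hg₀.integrable.sub (hg i).integrable).pos_part
    rw [integral_add (i1.const_mul 2) (by exact (hg i).integrable.sub hg₀.integrable),
      integral_const_mul,
      integral_sub (hg i).integrable hg₀.integrable, (hg i).integral_eq_one, hg₀.integral_eq_one]
    ring
  simp_rw [h1]
  have h2 : Tendsto (fun i => ∫ z, max (g₀ z - g i z) 0) l (𝓝 (∫ _ : X, (0 : ℝ))) := by
    refine tendsto_integral_filter_of_dominated_convergence g₀ (Eventually.of_forall fun i =>
      ((hg₀.integrable.sub (hg i).integrable).pos_part).aestronglyMeasurable)
      (Eventually.of_forall fun i => ?_) hg₀.integrable (Eventually.of_forall fun z => ?_)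
    · filter_upwards [(hg i).nonneg, hg₀.nonneg] with z hz hz₀
      rw [Real.norm_of_nonneg (le_max_right _ _)]
      exact max_le (by linarith) hz₀
    · have := ((tendsto_const_nhds (x := g₀ z)).sub (h z)).max (tendsto_const_nhds (x := (0 : ℝ)))
      simpa using this
  simpa using h2.const_mul 2

end ProbDensity

/-! ### Fourier transform in the frame of free transport -/

section MovingFourier

open Filter Topology

variable {V : Type*} [NormedAddCommGroup V] [NormedSpace ℝ V] [FiniteDimensional ℝ V]
  [MeasureSpace V] [BorelSpace V] [(volume : Measure V).IsAddHaarMeasure]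

/-- The Fourier transform of `f t` in the frame of free transport, at the frequencies `ℓ`, `m`. -/
noncomputable def movingFourier (f : ℝ → V × V → ℝ) (t : ℝ) (ℓ m : V →L[ℝ] ℝ) : ℂ :=
  ∫ z, (f t z : ℂ) * planeWave ℓ m t z

lemma continuous_planeWave (ℓ m : V →L[ℝ] ℝ) (t : ℝ) : Continuous (planeWave ℓ m t) :=
  (contDiff_planeWave ℓ m).continuous.comp (by fun_prop : Continuous fun z : V × V => (t, z))

lemma integrable_mul_planeWave {g : V × V → ℝ} (hg : Integrable g) (ℓ m : V →L[ℝ] ℝ) (t : ℝ) :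
    Integrable fun z => (g z : ℂ) * planeWave ℓ m t z :=
  hg.ofReal.mul_bdd (c := 1) (continuous_planeWave ℓ m t).aestronglyMeasurable
    (Eventually.of_forall fun z => (norm_planeWave ℓ m t z).le)

lemma norm_movingFourier_le {f : ℝ → V × V → ℝ} {t : ℝ} (hf : IsProbDensity (f t))
    (ℓ m : V →L[ℝ] ℝ) : ‖movingFourier f t ℓ m‖ ≤ 1 := by
  rw [← hf.integral_norm]
  refine (norm_integral_le_integral_norm _).trans_eq ?_
  simp [norm_planeWave]

/-- Joint continuity in time and frequencies. In time it comes from Scheffé's lemma: no domination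
of the densities `f t` is assumed. -/
lemma continuous_movingFourier {X : Type*} [TopologicalSpace X] [FirstCountableTopology X]
    {f : ℝ → V × V → ℝ} (hfc : Continuous fun p : ℝ × (V × V) => f p.1 p.2)
    (hf : ∀ t, IsProbDensity (f t)) {τ : X → ℝ} {ℓ m : X → V →L[ℝ] ℝ} (hτ : Continuous τ)
    (hℓ : Continuous ℓ) (hm : Continuous m) :
    Continuous fun p => movingFourier f (τ p) (ℓ p) (m p) := by
  refine continuous_iff_continuousAt.2 fun p₀ => ?_
  have h1 : Tendsto (fun p => ∫ z, ‖f (τ p) z - f (τ p₀) z‖) (𝓝 p₀) (𝓝 0) := by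
    refine tendsto_integral_norm_sub_of_isProbDensity (fun p => hf _) (hf _) fun z => ?_
    have : Continuous fun p => f (τ p) z :=
      hfc.comp (by fun_prop : Continuous fun p => (τ p, z))
    exact this.tendsto p₀
  have h2 : Tendsto (fun p => ∫ z, (f (τ p₀) z : ℂ) * planeWave (ℓ p) (m p) (τ p) z) (𝓝 p₀)
      (𝓝 (movingFourier f (τ p₀) (ℓ p₀) (m p₀))) := by
    refine tendsto_integral_filter_of_dominated_convergence (fun z => ‖f (τ p₀) z‖)
      (Eventually.of_forall fun p =>
        (integrable_mul_planeWave (hf _).integrable _ _ _).aestronglyMeasurable)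
      (Eventually.of_forall fun p => Eventually.of_forall fun z => ?_)
      (hf _).integrable.norm (Eventually.of_forall fun z => ?_)
    · simp [norm_planeWave]
    · have : Continuous fun p => (f (τ p₀) z : ℂ) * planeWave (ℓ p) (m p) (τ p) z := by
        unfold planeWave; fun_prop
      exact this.tendsto p₀
  have h3 : Tendsto (fun p => movingFourier f (τ p) (ℓ p) (m p)
      - ∫ z, (f (τ p₀) z : ℂ) * planeWave (ℓ p) (m p) (τ p) z) (𝓝 p₀) (𝓝 0) := by
    refine squeeze_zero_norm (fun p => ?_) h1
    rw [movingFourier, ← integral_sub (integrable_mul_planeWave (hf _).integrable _ _ _)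
      (integrable_mul_planeWave (hf _).integrable _ _ _)]
    refine (norm_integral_le_integral_norm _).trans_eq ?_
    refine integral_congr_ae (Eventually.of_forall fun z => ?_)
    simp only
    rw [← sub_mul, norm_mul, norm_planeWave, mul_one, ← Complex.ofReal_sub, Complex.norm_real]
  have := h3.add h2
  simpa [ContinuousAt] using this

/-- Multiplication by a superposition of plane waves in `x` becomes a superposition of frequency
shifts. -/
lemma integral_superposition_mul_planeWave {E : Type*} [NormedAddCommGroup E] [NormedSpace ℝ E]
    [MeasureSpace E] [BorelSpace E] [SecondCountableTopology E] [SFinite (volume : Measure E)]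
    {f : ℝ → V × V → ℝ} {t : ℝ} (hf : Integrable (f t)) {q : E → ℂ} (hq : Integrable q)
    (κ : E →L[ℝ] V →L[ℝ] ℝ) (ℓ m : V →L[ℝ] ℝ) :
    ∫ z, (f t z : ℂ) * ((∫ h, q h * Complex.exp (Complex.I * (κ h z.1 : ℝ))) * planeWave ℓ m t z)
      = ∫ h, q h * movingFourier f t (ℓ + κ h) (m - t • κ h) := by
  have hsh : ∀ h (z : V × V), Complex.exp (Complex.I * (κ h z.1 : ℝ)) * planeWave ℓ m t z
      = planeWave (ℓ + κ h) (m - t • κ h) t z := fun h z => by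
    rw [planeWave, planeWave, ← Complex.exp_add]
    congr 1
    simp
    ring
  have hint : Integrable (Function.uncurry fun (z : V × V) (h : E) =>
      (f t z : ℂ) * (q h * planeWave (ℓ + κ h) (m - t • κ h) t z))
      ((volume : Measure (V × V)).prod (volume : Measure E)) := by
    have h1 : Integrable (fun p : (V × V) × E => (f t p.1 : ℂ) * q p.2)
        ((volume : Measure (V × V)).prod (volume : Measure E)) := hf.ofReal.mul_prod hq
    have hc : Continuous fun p : (V × V) × E => planeWave (ℓ + κ p.2) (m - t • κ p.2) t p.1 := by
      unfold planeWave; fun_prop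
    refine (h1.mul_bdd (c := 1) hc.aestronglyMeasurable
      (Eventually.of_forall fun p => (norm_planeWave _ _ t p.1).le)).congr
      (Eventually.of_forall fun p => ?_)
    simp [Function.uncurry, mul_assoc]
  calc _ = ∫ z, ∫ h, (f t z : ℂ) * (q h * planeWave (ℓ + κ h) (m - t • κ h) t z) := by
        refine integral_congr_ae (Eventually.of_forall fun z => ?_)
        simp only
        rw [← integral_mul_const, ← integral_const_mul]
        refine integral_congr_ae (Eventually.of_forall fun h => ?_)
        simp only
        rw [mul_assoc, hsh]
    _ = _ := by
        rw [integral_integral_swap hint]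
        refine integral_congr_ae (Eventually.of_forall fun h => ?_)
        simp only [movingFourier]
        rw [← integral_const_mul]
        refine integral_congr_ae (Eventually.of_forall fun z => ?_)
        simp only
        ring

end MovingFourier

/-! ### Functions with an integrable Fourier transform -/

section FourierRepresentation

variable {E : Type*} [NormedAddCommGroup E] [InnerProductSpace ℝ E] [FiniteDimensional ℝ E]
  [MeasureSpace E] [BorelSpace E]

open Filter Topology

/-- The derivative of `x ↦ k(h) e^{i h·x}`. -/
noncomputable def waveDeriv (k : E → ℂ) (x h : E) : E →L[ℝ] ℂ :=
  (k h * (Complex.exp (Complex.I * (inner ℝ h x : ℝ)) * Complex.I)) •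
    Complex.ofRealCLM.comp (innerSL ℝ h)

lemma norm_waveDeriv_le (k : E → ℂ) (x h : E) : ‖waveDeriv k x h‖ ≤ ‖h‖ * ‖k h‖ := by
  refine ContinuousLinearMap.opNorm_le_bound _ (by positivity) fun c => ?_
  simp only [waveDeriv, smul_apply, ContinuousLinearMap.comp_apply, smul_eq_mul, norm_mul,
    Complex.norm_I, mul_one]
  rw [mul_comm Complex.I, Complex.norm_exp_ofReal_mul_I, mul_one]
  simp only [Complex.ofRealCLM_apply, Complex.norm_real, innerSL_apply_apply]
  calc ‖k h‖ * ‖inner ℝ h c‖ ≤ ‖k h‖ * (‖h‖ * ‖c‖) := by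
        gcongr; exact norm_inner_le_norm h c
    _ = _ := by ring

lemma aestronglyMeasurable_waveDeriv {k : E → ℂ} (hk : Integrable k) (x : E) :
    AEStronglyMeasurable (waveDeriv k x) := by
  unfold waveDeriv
  refine AEStronglyMeasurable.smul (hk.aestronglyMeasurable.mul ?_) ?_
  · exact Continuous.aestronglyMeasurable (by fun_prop)
  · refine Continuous.aestronglyMeasurable ?_
    exact (ContinuousLinearMap.compL ℝ E ℝ ℂ Complex.ofRealCLM).continuous.comp
      (innerSL ℝ).continuous

variable {Ψ : E → ℝ} {k : E → ℂ}

lemma hasFDerivAt_ofReal_of_fourier (hk : Integrable k) (hk1 : Integrable fun h => ‖h‖ * ‖k h‖)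
    (hΨ : ∀ x, (Ψ x : ℂ) = ∫ h, k h * Complex.exp (Complex.I * (inner ℝ h x : ℝ))) (x : E) :
    HasFDerivAt (fun x => (Ψ x : ℂ)) (∫ h, waveDeriv k x h) x := by
  simp_rw [hΨ]
  refine hasFDerivAt_integral_of_dominated_of_fderiv_le (bound := fun h => ‖h‖ * ‖k h‖)
    (s := Set.univ) Filter.univ_mem (Eventually.of_forall fun y => ?_) ?_
    (aestronglyMeasurable_waveDeriv hk x)
    (Eventually.of_forall fun h y _ => norm_waveDeriv_le k y h) hk1
    (Eventually.of_forall fun h y _ => ?_)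
  · exact hk.aestronglyMeasurable.mul (Continuous.aestronglyMeasurable (by fun_prop))
  · refine hk.mul_bdd (c := 1) (Continuous.aestronglyMeasurable (by fun_prop))
      (Eventually.of_forall fun h => ?_)
    rw [mul_comm, Complex.norm_exp_ofReal_mul_I]
  · have h1 : HasFDerivAt (fun y : E => ((inner ℝ h y : ℝ) : ℂ))
        (Complex.ofRealCLM.comp (innerSL ℝ h)) y :=
      (Complex.ofRealCLM.comp (innerSL ℝ h)).hasFDerivAt
    have h2 := ((h1.const_mul Complex.I).cexp).const_mul (k h)
    refine h2.congr_fderiv ?_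
    ext c
    simp [waveDeriv]
    ring

lemma hasFDerivAt_of_fourier (hk : Integrable k) (hk1 : Integrable fun h => ‖h‖ * ‖k h‖)
    (hΨ : ∀ x, (Ψ x : ℂ) = ∫ h, k h * Complex.exp (Complex.I * (inner ℝ h x : ℝ))) (x : E) :
    HasFDerivAt Ψ (Complex.reCLM.comp (∫ h, waveDeriv k x h)) x :=
  Complex.reCLM.hasFDerivAt.comp x (hasFDerivAt_ofReal_of_fourier hk hk1 hΨ x)

lemma ofReal_fderiv_apply_of_fourier (hk : Integrable k)
    (hk1 : Integrable fun h => ‖h‖ * ‖k h‖)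
    (hΨ : ∀ x, (Ψ x : ℂ) = ∫ h, k h * Complex.exp (Complex.I * (inner ℝ h x : ℝ))) (x c : E) :
    ((fderiv ℝ Ψ x c : ℝ) : ℂ) = ∫ h, (k h * (Complex.I * (inner ℝ h c : ℝ)))
      * Complex.exp (Complex.I * (inner ℝ h x : ℝ)) := by
  have h1 := hasFDerivAt_of_fourier hk hk1 hΨ x
  have h2 : HasFDerivAt (fun x => (Ψ x : ℂ)) (Complex.ofRealCLM.comp (fderiv ℝ Ψ x)) x :=
    Complex.ofRealCLM.hasFDerivAt.comp x h1.differentiableAt.hasFDerivAt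
  have h3 := h2.unique (hasFDerivAt_ofReal_of_fourier hk hk1 hΨ x)
  have h4 := congrArg (fun L : E →L[ℝ] ℂ => L c) h3
  simp only [ContinuousLinearMap.comp_apply, Complex.ofRealCLM_apply] at h4
  rw [h4, ContinuousLinearMap.integral_apply]
  · refine integral_congr_ae (Eventually.of_forall fun h => ?_)
    simp [waveDeriv]
    ring
  · exact hk1.mono' (aestronglyMeasurable_waveDeriv hk x)
      (Eventually.of_forall fun h => norm_waveDeriv_le k x h)

lemma contDiff_of_fourier (hk : Integrable k) (hk1 : Integrable fun h => ‖h‖ * ‖k h‖)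
    (hΨ : ∀ x, (Ψ x : ℂ) = ∫ h, k h * Complex.exp (Complex.I * (inner ℝ h x : ℝ))) :
    ContDiff ℝ 1 Ψ := by
  refine contDiff_one_iff_hasFDerivAt.2
    ⟨fun x => Complex.reCLM.comp (∫ h, waveDeriv k x h), ?_, hasFDerivAt_of_fourier hk hk1 hΨ⟩
  refine (ContinuousLinearMap.compL ℝ E ℂ ℝ Complex.reCLM).continuous.comp ?_
  refine continuous_of_dominated (bound := fun h => ‖h‖ * ‖k h‖)
    (fun x => aestronglyMeasurable_waveDeriv hk x)
    (fun x => Eventually.of_forall fun h => norm_waveDeriv_le k x h) hk1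
    (Eventually.of_forall fun h => ?_)
  unfold waveDeriv
  fun_prop

lemma norm_fderiv_le_of_fourier (hk : Integrable k) (hk1 : Integrable fun h => ‖h‖ * ‖k h‖)
    (hΨ : ∀ x, (Ψ x : ℂ) = ∫ h, k h * Complex.exp (Complex.I * (inner ℝ h x : ℝ))) (x : E) :
    ‖fderiv ℝ Ψ x‖ ≤ ∫ h, ‖h‖ * ‖k h‖ := by
  rw [(hasFDerivAt_of_fourier hk hk1 hΨ x).fderiv]
  refine (ContinuousLinearMap.opNorm_comp_le _ _).trans ?_
  rw [Complex.reCLM_norm, one_mul]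
  exact norm_integral_le_of_norm_le hk1 (Eventually.of_forall fun h => norm_waveDeriv_le k x h)

end FourierRepresentation

/-! ### Forces as superpositions of plane waves -/

section Forces

open Filter Topology

variable {d : ℕ}

/-- The pairing `∑ᵢ ξᵢ·xᵢ` of `n`-particle frequencies and positions. -/
noncomputable def pairing (d n : ℕ) :
    (Fin n → PhysSpace d) →L[ℝ] (Fin n → PhysSpace d) →L[ℝ] ℝ :=
  ∑ i, (innerSL ℝ).bilinearComp (ContinuousLinearMap.proj i) (ContinuousLinearMap.proj i)

lemma pairing_apply {n : ℕ} (ξ x : Fin n → PhysSpace d) :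
    pairing d n ξ x = ∑ i, inner ℝ (ξ i) (x i) := by
  simp [pairing]

lemma inner_gradient {Ψ : PhysSpace d → ℝ} (x c : PhysSpace d) :
    inner ℝ (gradient Ψ x) c = fderiv ℝ Ψ x c := by
  rw [gradient, InnerProductSpace.toDual_symm_apply]

lemma norm_gradient {Ψ : PhysSpace d → ℝ} (x : PhysSpace d) :
    ‖gradient Ψ x‖ = ‖fderiv ℝ Ψ x‖ := by
  rw [gradient, LinearIsometryEquiv.norm_map]

lemma continuous_gradient {Ψ : PhysSpace d → ℝ} (hΨ : ContDiff ℝ 1 Ψ) :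
    Continuous (gradient Ψ) :=
  (InnerProductSpace.toDual ℝ (PhysSpace d)).symm.continuous.comp
    (hΨ.continuous_fderiv one_ne_zero)

lemma fderiv_neg_of_even {Φ : PhysSpace d → ℝ} (hΦ : ∀ x, Φ (-x) = Φ x) (x : PhysSpace d) :
    fderiv ℝ Φ (-x) = -fderiv ℝ Φ x := by
  have h := fderiv_comp_smul (𝕜 := ℝ) (f := Φ) (x := x) (-1)
  simp only [neg_smul, one_smul, hΦ] at h
  rw [h, neg_neg]

/-- Since `Φ` is even, the terms of the double sum with first index `k` and with second index `k`
contribute equally, which cancels the factor `1 / 2`. -/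
lemma gradPotentialN_apply {Φ : PhysSpace d → ℝ} (hΦ : ∀ x, Φ (-x) = Φ x) (hC : ContDiff ℝ 1 Φ)
    (N : ℕ) (x : Fin N → PhysSpace d) (k : Fin N) :
    gradPotentialN Φ N x k = (1 / (N : ℝ)) • ∑ l, gradient Φ (x k - x l) := by
  have hu : ∀ i, HasFDerivAt (fun y => Function.update x k y i)
      (if i = k then ContinuousLinearMap.id ℝ (PhysSpace d) else 0) (x k) := fun i => by
    split_ifs with h
    · subst h; simpa using! hasFDerivAt_id (x i)
    · simpa [h] using hasFDerivAt_const (x i) (x k)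
  have hd : ∀ i l, HasFDerivAt (fun y => Φ (Function.update x k y i - Function.update x k y l))
      ((fderiv ℝ Φ (x i - x l)).comp ((if i = k then ContinuousLinearMap.id ℝ (PhysSpace d) else 0)
        - if l = k then ContinuousLinearMap.id ℝ (PhysSpace d) else 0)) (x k) := fun i l =>
    HasFDerivAt.comp (g := Φ) (x k) (by simpa using ((hC.differentiable one_ne_zero) _).hasFDerivAt)
      ((hu i).fun_sub (hu l))
  have hs : HasFDerivAt (fun y => potentialN Φ N (Function.update x k y))
      ((1 / (2 * (N : ℝ))) • ∑ i, ∑ l, (fderiv ℝ Φ (x i - x l)).comp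
        ((if i = k then ContinuousLinearMap.id ℝ (PhysSpace d) else 0)
        - if l = k then ContinuousLinearMap.id ℝ (PhysSpace d) else 0)) (x k) :=
    (HasFDerivAt.fun_sum fun i _ => HasFDerivAt.fun_sum fun l _ => hd i l).const_mul _
  refine ext_inner_right ℝ fun c => ?_
  rw [gradPotentialN, inner_gradient, hs.fderiv, real_inner_smul_left, sum_inner]
  simp_rw [inner_gradient]
  have e : ∀ i l, (fderiv ℝ Φ (x i - x l)).comp
        ((if i = k then ContinuousLinearMap.id ℝ (PhysSpace d) else 0)
        - if l = k then ContinuousLinearMap.id ℝ (PhysSpace d) else 0) c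
      = (if i = k then fderiv ℝ Φ (x i - x l) c else 0)
        - if l = k then fderiv ℝ Φ (x i - x l) c else 0 := fun i l => by
    split_ifs <;> simp
  have odd : ∀ i, fderiv ℝ Φ (x i - x k) c = -fderiv ℝ Φ (x k - x i) c := fun i => by
    rw [← neg_sub, fderiv_neg_of_even hΦ]; rfl
  simp only [smul_apply, sum_apply, e, Finset.sum_sub_distrib, smul_eq_mul]
  rw [Finset.sum_comm]
  simp only [Finset.sum_ite_eq', Finset.mem_univ, if_true, odd, Finset.sum_neg_distrib]
  ring

variable {Φ : PhysSpace d → ℝ} {Φhat : PhysSpace d → ℂ}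

lemma continuous_integral_mul_inner (hΦ : IsFourierTransform Φ Φhat)
    (hΦ1 : Integrable fun h => ‖h‖ * ‖Φhat h‖) {H : ℝ → PhysSpace d → ℂ}
    (hs : ∀ h, Continuous fun s => H s h) (hh : ∀ s, Continuous (H s)) (hb : ∀ s h, ‖H s h‖ ≤ 1)
    (ξ η : PhysSpace d) :
    Continuous fun s : ℝ => ∫ h, Φhat h * (inner ℝ h (η + s • ξ) : ℝ) * H s h := by
  refine continuous_iff_continuousAt.2 fun s₀ => ?_
  refine continuousAt_of_dominated (bound := fun h => (‖h‖ * ‖Φhat h‖) * (‖η‖ + (|s₀| + 1) * ‖ξ‖))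
    (Eventually.of_forall fun s => ?_) ?_ (hΦ1.mul_const _) (Eventually.of_forall fun h => ?_)
  · have := hh s
    refine (hΦ.integrable.aestronglyMeasurable.mul ?_).mul this.aestronglyMeasurable
    exact Continuous.aestronglyMeasurable (by fun_prop)
  · filter_upwards [Metric.ball_mem_nhds s₀ one_pos] with s hs1
    refine Eventually.of_forall fun h => ?_
    have hs2 : |s| ≤ |s₀| + 1 := by
      have h1 : |s - s₀| < 1 := by simpa [Real.dist_eq] using hs1
      have h2 := abs_sub_abs_le_abs_sub s s₀
      linarith
    have h3 : ‖η + s • ξ‖ ≤ ‖η‖ + (|s₀| + 1) * ‖ξ‖ := by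
      refine (norm_add_le _ _).trans ?_
      rw [norm_smul, Real.norm_eq_abs]; gcongr
    rw [norm_mul, norm_mul, Complex.norm_real]
    calc ‖Φhat h‖ * ‖inner ℝ h (η + s • ξ)‖ * ‖H s h‖
        ≤ ‖Φhat h‖ * (‖h‖ * (‖η‖ + (|s₀| + 1) * ‖ξ‖)) * 1 := by
          gcongr
          · exact (norm_inner_le_norm _ _).trans (by gcongr)
          · exact hb s h
      _ = _ := by ring
  · have := hs h
    exact Continuous.continuousAt (by fun_prop)

lemma integrable_mul_inner (hΦ : IsFourierTransform Φ Φhat)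
    (hΦ1 : Integrable fun h => ‖h‖ * ‖Φhat h‖) (c : PhysSpace d) :
    Integrable fun h => Φhat h * (inner ℝ h c : ℝ) := by
  refine (hΦ1.mul_const ‖c‖).mono' (hΦ.integrable.aestronglyMeasurable.mul
    (Continuous.aestronglyMeasurable (by fun_prop))) (Eventually.of_forall fun h => ?_)
  rw [norm_mul, Complex.norm_real]
  calc ‖Φhat h‖ * ‖inner ℝ h c‖ ≤ ‖Φhat h‖ * (‖h‖ * ‖c‖) := by
        gcongr; exact norm_inner_le_norm _ _
    _ = _ := by ring

/-- A function whose increments are integrals of a continuous function is differentiable. -/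
lemma hasDerivAt_of_sub_eq_integral {G D : ℝ → ℂ} (hD : Continuous D)
    (h : ∀ t₁ t₂, G t₂ - G t₁ = ∫ s in t₁..t₂, D s) (t : ℝ) : HasDerivAt G (D t) t := by
  have h1 : G = fun t => G 0 + ∫ s in (0 : ℝ)..t, D s := by
    funext t; rw [← h]; ring
  rw [h1]
  exact (intervalIntegral.integral_hasDerivAt_right (hD.intervalIntegrable _ _)
    (hD.stronglyMeasurableAtFilter _ _) hD.continuousAt).const_add _

/-! ### The Liouville equation in Fourier variables -/

/-- The transform, in the moving frame, of an `n`-particle density. -/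
noncomputable def movingFourierN {n : ℕ} (F : ℝ → PhaseSpace d n → ℝ) (t : ℝ)
    (ξ η : Fin n → PhysSpace d) : ℂ :=
  movingFourier F t (pairing d n ξ) (pairing d n η)

/-- The frequency shift by which particles `k` and `l` exchange `h`. -/
noncomputable def exchange {N : ℕ} (k l : Fin N) (h : PhysSpace d) : Fin N → PhysSpace d :=
  Pi.single k h - Pi.single l h

lemma pairing_exchange {N : ℕ} (k l : Fin N) (h : PhysSpace d) (x : Fin N → PhysSpace d) :
    pairing d N (exchange k l h) x = inner ℝ h (x k - x l) := by
  rw [exchange, map_sub, sub_apply, pairing_apply, pairing_apply, inner_sub_right]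
  congr 1
  · rw [Finset.sum_eq_single k (fun i _ hi => by simp [hi]) (by simp)]; simp
  · rw [Finset.sum_eq_single l (fun i _ hi => by simp [hi]) (by simp)]; simp

/-- `exchange k l` followed by the pairing, as a linear map. -/
noncomputable def exchangeL (d : ℕ) {N : ℕ} (k l : Fin N) :
    PhysSpace d →L[ℝ] (Fin N → PhysSpace d) →L[ℝ] ℝ :=
  (pairing d N).comp (ContinuousLinearMap.single ℝ (fun _ => PhysSpace d) k
    - ContinuousLinearMap.single ℝ (fun _ => PhysSpace d) l)

lemma exchangeL_apply {N : ℕ} (k l : Fin N) (h : PhysSpace d) :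
    exchangeL d k l h = pairing d N (exchange k l h) := by
  simp [exchangeL, exchange]

lemma continuous_exchange {N : ℕ} (k l : Fin N) :
    Continuous (exchange k l : PhysSpace d → Fin N → PhysSpace d) := by
  have h : ∀ k : Fin N, Continuous fun h : PhysSpace d => (Pi.single k h : Fin N → PhysSpace d) :=
    fun k => (ContinuousLinearMap.single ℝ (fun _ => PhysSpace d) k).continuous
  exact (h k).sub (h l)

lemma continuous_gradPotentialN (hΦe : ∀ x, Φ (-x) = Φ x) (hC : ContDiff ℝ 1 Φ) (N : ℕ) :
    Continuous (gradPotentialN Φ N) := by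
  refine continuous_pi fun k => ?_
  simp_rw [gradPotentialN_apply hΦe hC]
  have := continuous_gradient hC
  fun_prop

lemma norm_gradPotentialN_le (hΦe : ∀ x, Φ (-x) = Φ x) (hΦ : IsFourierTransform Φ Φhat)
    (hΦ1 : Integrable fun h => ‖h‖ * ‖Φhat h‖) {N : ℕ} (x : Fin N → PhysSpace d) :
    ‖gradPotentialN Φ N x‖ ≤ ∫ h, ‖h‖ * ‖Φhat h‖ := by
  have hC : ContDiff ℝ 1 Φ := contDiff_of_fourier hΦ.integrable hΦ1 hΦ.inversion
  have h0 : 0 ≤ ∫ h, ‖h‖ * ‖Φhat h‖ := integral_nonneg fun h => by positivity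
  refine (pi_norm_le_iff_of_nonneg h0).2 fun k => ?_
  have hN : (0 : ℝ) < N := by exact_mod_cast k.pos
  rw [gradPotentialN_apply hΦe hC, norm_smul, Real.norm_of_nonneg (by positivity)]
  have : ‖∑ l, gradient Φ (x k - x l)‖ ≤ ∑ _l : Fin N, ∫ h, ‖h‖ * ‖Φhat h‖ :=
    norm_sum_le_of_le _ fun l _ => by
      rw [norm_gradient]
      exact norm_fderiv_le_of_fourier hΦ.integrable hΦ1 hΦ.inversion _
  calc 1 / (N : ℝ) * ‖∑ l, gradient Φ (x k - x l)‖
      ≤ 1 / (N : ℝ) * ∑ _l : Fin N, ∫ h, ‖h‖ * ‖Φhat h‖ := by gcongr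
    _ = _ := by simp; field_simp

/-- Frequency representation of the `N`-body force. -/
lemma ofReal_pairing_gradPotentialN (hΦe : ∀ x, Φ (-x) = Φ x) (hΦ : IsFourierTransform Φ Φhat)
    (hΦ1 : Integrable fun h => ‖h‖ * ‖Φhat h‖) {N : ℕ} (c x : Fin N → PhysSpace d) :
    ((pairing d N c (gradPotentialN Φ N x) : ℝ) : ℂ)
      = (1 / (N : ℝ) : ℝ) * ∑ k, ∑ l, ∫ h, (Φhat h * (Complex.I * (inner ℝ h (c k) : ℝ)))
          * Complex.exp (Complex.I * (exchangeL d k l h x : ℝ)) := by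
  have hC : ContDiff ℝ 1 Φ := contDiff_of_fourier hΦ.integrable hΦ1 hΦ.inversion
  have e : pairing d N c (gradPotentialN Φ N x)
      = (1 / (N : ℝ)) * ∑ k, ∑ l, fderiv ℝ Φ (x k - x l) (c k) := by
    rw [pairing_apply, Finset.mul_sum]
    refine Finset.sum_congr rfl fun k _ => ?_
    rw [gradPotentialN_apply hΦe hC, real_inner_comm, real_inner_smul_left, sum_inner]
    simp_rw [inner_gradient]
  rw [e]
  push_cast
  congr 1
  refine Finset.sum_congr rfl fun k _ => Finset.sum_congr rfl fun l _ => ?_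
  rw [ofReal_fderiv_apply_of_fourier hΦ.integrable hΦ1 hΦ.inversion]
  simp_rw [exchangeL_apply, pairing_exchange]

/-- The inner double sum over pairs in the Fourier transform of the Liouville equation. -/
lemma integral_force_mul_planeWave (hΦe : ∀ x, Φ (-x) = Φ x) (hΦ : IsFourierTransform Φ Φhat)
    (hΦ1 : Integrable fun h => ‖h‖ * ‖Φhat h‖) {N : ℕ} {F : ℝ → PhaseSpace d N → ℝ} {s : ℝ}
    (hF : IsProbDensity (F s)) (ξ η : Fin N → PhysSpace d) :
    ∫ z, (F s z : ℂ) * (Complex.I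
        * (((pairing d N η + s • pairing d N ξ) (gradPotentialN Φ N z.1) : ℝ) : ℂ)
          * planeWave (pairing d N ξ) (pairing d N η) s z)
      = -((1 / (N : ℝ) : ℝ) * ∑ k, ∑ l, ∫ h, Φhat h * (inner ℝ h (η k + s • ξ k) : ℝ)
        * movingFourierN F s (ξ + exchange k l h) (η - s • exchange k l h)) := by
  have hC : ContDiff ℝ 1 Φ := contDiff_of_fourier hΦ.integrable hΦ1 hΦ.inversion
  have hq : ∀ c : PhysSpace d, Integrable fun h => Φhat h * (Complex.I * (inner ℝ h c : ℝ)) :=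
    fun c => ((integrable_mul_inner hΦ hΦ1 c).const_mul Complex.I).congr
      (Eventually.of_forall fun h => by simp only; ring)
  have hterm : ∀ k l, ∫ z, (F s z : ℂ) * ((∫ h, (Φhat h * (Complex.I
      * (inner ℝ h (η k + s • ξ k) : ℝ))) * Complex.exp (Complex.I * (exchangeL d k l h z.1 : ℝ)))
        * planeWave (pairing d N ξ) (pairing d N η) s z)
      = Complex.I * ∫ h, Φhat h * (inner ℝ h (η k + s • ξ k) : ℝ)
        * movingFourierN F s (ξ + exchange k l h)
          (η - s • exchange k l h) := fun k l => by
    rw [integral_superposition_mul_planeWave hF.integrable (hq _),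
      ← integral_const_mul]
    refine integral_congr_ae (Eventually.of_forall fun h => ?_)
    simp only [movingFourierN, map_add, map_sub, map_smul, exchangeL_apply]
    ring
  have hint : ∀ k l, Integrable fun z => (F s z : ℂ) * ((∫ h, (Φhat h * (Complex.I
      * (inner ℝ h (η k + s • ξ k) : ℝ))) * Complex.exp (Complex.I * (exchangeL d k l h z.1 : ℝ)))
        * planeWave (pairing d N ξ) (pairing d N η) s z) := fun k l => by
    have hc : Continuous fun z : PhaseSpace d N => ∫ h, (Φhat h * (Complex.I
        * (inner ℝ h (η k + s • ξ k) : ℝ))) * Complex.exp (Complex.I * (exchangeL d k l h z.1 : ℝ)) := by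
      simp_rw [exchangeL_apply, pairing_exchange, ← ofReal_fderiv_apply_of_fourier hΦ.integrable hΦ1 hΦ.inversion]
      have := hC.continuous_fderiv one_ne_zero
      fun_prop
    have h3 := (continuous_planeWave (pairing d N ξ) (pairing d N η) s)
    refine hF.integrable.ofReal.mul_bdd
      (c := ∫ h, ‖Φhat h * (Complex.I * (inner ℝ h (η k + s • ξ k) : ℝ))‖)
      (hc.mul h3).aestronglyMeasurable (Eventually.of_forall fun z => ?_)
    rw [norm_mul, norm_planeWave, mul_one]
    refine (norm_integral_le_integral_norm _).trans_eq ?_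
    refine integral_congr_ae (Eventually.of_forall fun h => ?_)
    simp only
    rw [norm_mul, mul_comm Complex.I ((exchangeL d k l h z.1 : ℝ) : ℂ),
      Complex.norm_exp_ofReal_mul_I, mul_one]
  have hsum : ∀ z : PhaseSpace d N, (F s z : ℂ) * (Complex.I
      * (((pairing d N η + s • pairing d N ξ) (gradPotentialN Φ N z.1) : ℝ) : ℂ)
        * planeWave (pairing d N ξ) (pairing d N η) s z)
      = (Complex.I * (1 / (N : ℝ) : ℝ)) * ∑ k, ∑ l, (F s z : ℂ) * ((∫ h, (Φhat h * (Complex.I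
      * (inner ℝ h (η k + s • ξ k) : ℝ))) * Complex.exp (Complex.I * (exchangeL d k l h z.1 : ℝ)))
        * planeWave (pairing d N ξ) (pairing d N η) s z) := fun z => by
    rw [← map_smul, ← map_add, ofReal_pairing_gradPotentialN hΦe hΦ hΦ1]
    simp only [Pi.add_apply, Pi.smul_apply]
    simp_rw [← Finset.mul_sum, ← Finset.sum_mul]
    ring
  simp_rw [hsum]
  rw [integral_const_mul, integral_finsetSum _ (fun k _ => integrable_finsetSum _
    fun l _ => hint k l)]
  simp_rw [integral_finsetSum _ (fun l _ => hint _ l), hterm, ← Finset.mul_sum]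
  linear_combination ((1 / (N : ℝ) : ℝ) : ℂ) * (∑ k, ∑ l, ∫ h, Φhat h
    * (inner ℝ h (η k + s • ξ k) : ℝ)
        * movingFourierN F s (ξ + exchange k l h)
          (η - s • exchange k l h)) * Complex.I_mul_I

/-- The Fourier transform of the Liouville equation in the moving frame: the force of particle `l`
on particle `k` exchanges the frequency `h` between the two. -/
theorem hasDerivAt_movingFourierN (hΦe : ∀ x, Φ (-x) = Φ x) (hΦ : IsFourierTransform Φ Φhat)
    (hΦ1 : Integrable fun h => ‖h‖ * ‖Φhat h‖) {N : ℕ} {f0 : PhaseSpace d N → ℝ}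
    {F : ℝ → PhaseSpace d N → ℝ} (hF : IsLiouvilleSolution Φ N f0 F)
    (ξ η : Fin N → PhysSpace d) (t : ℝ) :
    HasDerivAt (fun t => movingFourierN F t ξ η)
      (-((1 / (N : ℝ) : ℝ) * ∑ k, ∑ l, ∫ h, Φhat h * (inner ℝ h (η k + t • ξ k) : ℝ)
        * movingFourierN F t (ξ + exchange k l h)
            (η - t • exchange k l h))) t := by
  have hC : ContDiff ℝ 1 Φ := contDiff_of_fourier hΦ.integrable hΦ1 hΦ.inversion
  refine hasDerivAt_of_sub_eq_integral (D := fun t => (-((1 / (N : ℝ) : ℝ) * ∑ k, ∑ l,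
      ∫ h, Φhat h * (inner ℝ h (η k + t • ξ k) : ℝ)
        * movingFourierN F t (ξ + exchange k l h)
            (η - t • exchange k l h)))) ?_ (fun t₁ t₂ => ?_) t
  · refine (continuous_const.mul (continuous_finsetSum _ fun k _ =>
      continuous_finsetSum _ fun l _ => ?_)).neg
    refine continuous_integral_mul_inner hΦ hΦ1 (fun h => ?_) (fun s => ?_) (fun s h => ?_) _ _
    · exact continuous_movingFourier hF.contDiff.continuous hF.density continuous_id
        (by fun_prop) (by fun_prop)
    · have h1 := continuous_exchange (d := d) k l
      exact continuous_movingFourier hF.contDiff.continuous hF.density continuous_const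
        (by fun_prop) (by fun_prop)
    · exact norm_movingFourier_le (hF.density s) _ _
  · rw [movingFourierN, movingFourierN, movingFourier, movingFourier,
      integral_planeWave_sub_integral_planeWave hF.contDiff (fun _ => continuous_gradPotentialN hΦe hC N)
        (fun _ => norm_gradPotentialN_le hΦe hΦ hΦ1)
        hF.equation (fun t => (hF.density t).integrable) (fun t => (hF.density t).integral_norm.le)]
    refine intervalIntegral.integral_congr fun s _ => ?_
    exact integral_force_mul_planeWave hΦe hΦ hΦ1 (hF.density s) ξ η

/-! ### The Vlasov equation in Fourier variables -/

/-- The transform, in the moving frame, of a one-particle density. -/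
noncomputable def movingFourierOne (f : ℝ → PhysSpace d × PhysSpace d → ℝ) (t : ℝ)
    (ξ η : PhysSpace d) : ℂ :=
  movingFourier f t (innerSL ℝ ξ) (innerSL ℝ η)

lemma ofReal_meanFieldPotential (hΦ : IsFourierTransform Φ Φhat)
    (hΦ1 : Integrable fun h => ‖h‖ * ‖Φhat h‖)
    {f : ℝ → PhysSpace d × PhysSpace d → ℝ} {t : ℝ} (hf : IsProbDensity (f t)) (x : PhysSpace d) :
    (meanFieldPotential Φ (f t) x : ℂ) = ∫ h, (Φhat h * movingFourierOne f t (-h) (t • h))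
      * Complex.exp (Complex.I * (inner ℝ h x : ℝ)) := by
  have hC : Continuous Φ := (contDiff_of_fourier hΦ.integrable hΦ1 hΦ.inversion).continuous
  have hb : ∀ y, ‖Φ y‖ ≤ ∫ h, ‖Φhat h‖ := fun y => by
    rw [← Complex.norm_real, hΦ.inversion]
    refine (norm_integral_le_integral_norm _).trans_eq ?_
    refine integral_congr_ae (Eventually.of_forall fun h => ?_)
    simp only
    rw [norm_mul, mul_comm Complex.I, Complex.norm_exp_ofReal_mul_I, mul_one]
  have hint : Integrable (fun z : PhysSpace d × PhysSpace d => Φ (x - z.1) * f t z) :=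
    hf.integrable.bdd_mul (c := ∫ h, ‖Φhat h‖) (Continuous.aestronglyMeasurable (by fun_prop))
      (Eventually.of_forall fun z => hb _)
  have e1 : meanFieldPotential Φ (f t) x = ∫ z, Φ (x - z.1) * f t z := by
    rw [Measure.volume_eq_prod] at hint ⊢
    rw [integral_prod _ hint, meanFieldPotential]
    simp_rw [spatialDensity, integral_const_mul]
  have hq : Integrable fun h => Φhat h * Complex.exp (Complex.I * (inner ℝ h x : ℝ)) :=
    hΦ.integrable.mul_bdd (c := 1) (Continuous.aestronglyMeasurable (by fun_prop))
      (Eventually.of_forall fun h => by rw [mul_comm, Complex.norm_exp_ofReal_mul_I])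
  have key := integral_superposition_mul_planeWave hf.integrable hq (-innerSL ℝ) 0 0
  rw [e1, ← integral_complex_ofReal]
  calc _ = ∫ z, (f t z : ℂ) * ((∫ h, (Φhat h * Complex.exp (Complex.I * (inner ℝ h x : ℝ)))
        * Complex.exp (Complex.I * ((-innerSL ℝ) h z.1 : ℝ))) * planeWave 0 0 t z) := by
        refine integral_congr_ae (Eventually.of_forall fun z => ?_)
        simp only
        rw [Complex.ofReal_mul, hΦ.inversion, mul_comm]
        congr 1
        have : planeWave 0 0 t z = 1 := by simp [planeWave]
        rw [this, mul_one]
        refine integral_congr_ae (Eventually.of_forall fun h => ?_)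
        simp only
        rw [mul_assoc, ← Complex.exp_add]
        congr 2
        simp [inner_sub_right]
        ring
    _ = _ := by
        rw [key]
        refine integral_congr_ae (Eventually.of_forall fun h => ?_)
        simp [movingFourierOne]
        ring

/-- The Fourier transform of the Vlasov equation in the moving frame. -/
theorem hasDerivAt_movingFourierOne (hΦ : IsFourierTransform Φ Φhat)
    (hΦ1 : Integrable fun h => ‖h‖ * ‖Φhat h‖) {f0 : PhysSpace d × PhysSpace d → ℝ}
    {f : ℝ → PhysSpace d × PhysSpace d → ℝ} (hf : IsVlasovSolution Φ f0 f)
    (ξ η : PhysSpace d) (t : ℝ) :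
    HasDerivAt (fun t => movingFourierOne f t ξ η)
      (-∫ h, Φhat h * (inner ℝ h (η + t • ξ) : ℝ)
        * (movingFourierOne f t (-h) (t • h) * movingFourierOne f t (ξ + h) (η - t • h))) t := by
  have hr1 : ∀ s ξ η, ‖movingFourierOne f s ξ η‖ ≤ 1 := fun s ξ η =>
    norm_movingFourier_le (hf.density s) _ _
  have hrc : ∀ s, Continuous fun h : PhysSpace d => movingFourierOne f s (-h) (s • h) := fun s =>
    continuous_movingFourier hf.contDiff.continuous hf.density continuous_const
      (by fun_prop) (by fun_prop)
  have hΨ := fun s x => ofReal_meanFieldPotential hΦ hΦ1 (hf.density s) x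
  have hk : ∀ s, Integrable fun h => Φhat h * movingFourierOne f s (-h) (s • h) := fun s =>
    hΦ.integrable.mul_bdd (c := 1) (hrc s).aestronglyMeasurable
      (Eventually.of_forall fun h => hr1 _ _ _)
  have hk1 : ∀ s, Integrable fun h => ‖h‖ * ‖Φhat h * movingFourierOne f s (-h) (s • h)‖ :=
    fun s => (hΦ1.mul_bdd (c := 1) (hrc s).norm.aestronglyMeasurable
      (Eventually.of_forall fun h => by simpa using hr1 _ _ _)).congr
      (Eventually.of_forall fun h => by simp only [norm_mul]; ring)
  have hk1le : ∀ s, ∫ h, ‖h‖ * ‖Φhat h * movingFourierOne f s (-h) (s • h)‖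
      ≤ ∫ h, ‖h‖ * ‖Φhat h‖ := fun s => by
    refine integral_mono (hk1 s) hΦ1 fun h => ?_
    simp only [norm_mul]
    exact mul_le_mul_of_nonneg_left (mul_le_of_le_one_right (norm_nonneg _) (hr1 _ _ _))
      (norm_nonneg _)
  have hgc : ∀ s, Continuous (gradient (meanFieldPotential Φ (f s))) := fun s =>
    continuous_gradient (contDiff_of_fourier (hk s) (hk1 s) (hΨ s))
  have hgb : ∀ s x, ‖gradient (meanFieldPotential Φ (f s)) x‖ ≤ ∫ h, ‖h‖ * ‖Φhat h‖ :=
    fun s x => by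
      rw [norm_gradient]
      exact (norm_fderiv_le_of_fourier (hk s) (hk1 s) (hΨ s) x).trans (hk1le s)
  have hq : ∀ s (c : PhysSpace d), Integrable fun h =>
      (Φhat h * movingFourierOne f s (-h) (s • h)) * (Complex.I * (inner ℝ h c : ℝ)) :=
    fun s c => (((integrable_mul_inner hΦ hΦ1 c).const_mul Complex.I).mul_bdd (c := 1)
      (hrc s).aestronglyMeasurable (Eventually.of_forall fun h => hr1 _ _ _)).congr
      (Eventually.of_forall fun h => by simp only; ring)
  refine hasDerivAt_of_sub_eq_integral (D := fun t =>
    (-∫ h, Φhat h * (inner ℝ h (η + t • ξ) : ℝ)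
        * (movingFourierOne f t (-h) (t • h) * movingFourierOne f t (ξ + h) (η - t • h))))
    ?_ (fun t₁ t₂ => ?_) t
  · refine (continuous_integral_mul_inner hΦ hΦ1 (fun h => ?_) (fun s => ?_) (fun s h => ?_)
      _ _).neg
    · exact (continuous_movingFourier hf.contDiff.continuous hf.density continuous_id
        (by fun_prop) (by fun_prop)).mul (continuous_movingFourier hf.contDiff.continuous
          hf.density continuous_id (by fun_prop) (by fun_prop))
    · exact (hrc s).mul (continuous_movingFourier hf.contDiff.continuous hf.density
        continuous_const (by fun_prop) (by fun_prop))
    · rw [norm_mul]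
      exact mul_le_one₀ (hr1 _ _ _) (norm_nonneg _) (hr1 _ _ _)
  · rw [movingFourierOne, movingFourierOne, movingFourier, movingFourier,
      integral_planeWave_sub_integral_planeWave hf.contDiff hgc hgb
        hf.equation (fun t => (hf.density t).integrable) (fun t => (hf.density t).integral_norm.le)]
    refine intervalIntegral.integral_congr fun s _ => ?_
    have hrep : ∀ x, (((innerSL ℝ η + s • innerSL ℝ ξ)
        (gradient (meanFieldPotential Φ (f s)) x) : ℝ) : ℂ)
        = ∫ h, ((Φhat h * movingFourierOne f s (-h) (s • h))
          * (Complex.I * (inner ℝ h (η + s • ξ) : ℝ)))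
          * Complex.exp (Complex.I * (innerSL ℝ h x : ℝ)) := fun x => by
      have e : (innerSL ℝ η + s • innerSL ℝ ξ) (gradient (meanFieldPotential Φ (f s)) x)
          = fderiv ℝ (meanFieldPotential Φ (f s)) x (η + s • ξ) := by
        rw [← inner_gradient, real_inner_comm, ← map_smul, ← map_add]; rfl
      rw [e, ofReal_fderiv_apply_of_fourier (hk s) (hk1 s) (hΨ s)]
      rfl
    calc _ = ∫ z, Complex.I * ((f s z : ℂ) * ((∫ h, ((Φhat h * movingFourierOne f s (-h) (s • h))
          * (Complex.I * (inner ℝ h (η + s • ξ) : ℝ)))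
          * Complex.exp (Complex.I * (innerSL ℝ h z.1 : ℝ)))
            * planeWave (innerSL ℝ ξ) (innerSL ℝ η) s z)) := by
          refine integral_congr_ae (Eventually.of_forall fun z => ?_)
          simp only
          rw [hrep]
          ring
      _ = _ := by
          rw [integral_const_mul, integral_superposition_mul_planeWave (hf.density s).integrable
            (hq s _), ← integral_const_mul, ← integral_neg]
          refine integral_congr_ae (Eventually.of_forall fun h => ?_)
          simp only [movingFourierOne, map_add, map_sub, map_smul]
          linear_combination (Φhat h * (inner ℝ h (η + s • ξ) : ℝ)
            * movingFourier f s (innerSL ℝ (-h)) (s • innerSL ℝ h)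
            * movingFourier f s (innerSL ℝ ξ + innerSL ℝ h) (innerSL ℝ η - s • innerSL ℝ h))
              * Complex.I_mul_I

end Forces

/-! ### Shrinking analyticity weights -/

section Contraction

open Filter Topology

/-- A bound that can be improved from `c + r` to `c + r / 2` for every `r ≥ 0`, and that holds for
some `r`, holds with `c`. -/
lemma le_mul_of_forall_halving {ι : Type*} {I : Set ι} {q w : ι → ℝ} {c r₀ : ℝ} (hr₀ : 0 ≤ r₀)
    (h0 : ∀ i ∈ I, q i ≤ (c + r₀) * w i)
    (step : ∀ r, 0 ≤ r → (∀ i ∈ I, q i ≤ (c + r) * w i) → ∀ i ∈ I, q i ≤ (c + r / 2) * w i) :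
    ∀ i ∈ I, q i ≤ c * w i := by
  have h : ∀ n : ℕ, ∀ i ∈ I, q i ≤ (c + r₀ * (1 / 2) ^ n) * w i := fun n => by
    induction n with
    | zero => simpa using h0
    | succ n ih =>
      have := step _ (by positivity) ih
      rw [pow_succ]
      convert this using 6
      ring
  intro i hi
  have ht : Tendsto (fun n : ℕ => (c + r₀ * (1 / 2 : ℝ) ^ n) * w i) atTop (𝓝 ((c + r₀ * 0) * w i)) :=
    ((tendsto_const_nhds).add (tendsto_const_nhds.mul
      (tendsto_pow_atTop_nhds_zero_of_lt_one (by norm_num) (by norm_num)))).mul_const _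
  simpa using ge_of_tendsto' ht fun n => h n i hi

/-- Integrated form of a derivative bound `A p e^{λ|s|p}`. -/
lemma norm_le_of_norm_deriv_le_exp {y y' : ℝ → ℂ} (hy : ∀ s, HasDerivAt y (y' s) s)
    {A lam p t₁ : ℝ} (hlam : 0 < lam)
    (hb : ∀ s, |s| ≤ t₁ → ‖y' s‖ ≤ A * p * Real.exp (lam * |s| * p)) {t : ℝ} (ht : |t| ≤ t₁) :
    ‖y t‖ ≤ ‖y 0‖ + A / lam * (Real.exp (lam * |t| * p) - 1) := by
  have key : ∀ {y y' : ℝ → ℂ}, (∀ s, HasDerivAt y (y' s) s) →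
      (∀ s, |s| ≤ t₁ → ‖y' s‖ ≤ A * p * Real.exp (lam * |s| * p)) → ∀ t, 0 ≤ t → t ≤ t₁ →
      ‖y t‖ ≤ ‖y 0‖ + A / lam * (Real.exp (lam * t * p) - 1) := by
    intro y y' hy hb t ht0 ht
    refine image_norm_le_of_norm_deriv_right_le_deriv_boundary (a := 0) (b := t) (f' := y')
      (B := fun s => ‖y 0‖ + A / lam * (Real.exp (lam * s * p) - 1))
      (B' := fun s => A * p * Real.exp (lam * s * p))
      (fun s _ => (hy s).continuousAt.continuousWithinAt) (fun s _ => (hy s).hasDerivWithinAt)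
      (by simp) (fun s => ?_) (fun s hs => ?_) ⟨ht0, le_rfl⟩
    · have h1 : HasDerivAt (fun s : ℝ => lam * s * p) (lam * 1 * p) s :=
        ((hasDerivAt_id s).const_mul lam).mul_const p
      have h2 := ((h1.exp.sub_const 1).const_mul (A / lam)).const_add ‖y 0‖
      convert! h2 using 1
      field_simp
    · have := hb s (by rw [abs_of_nonneg hs.1]; linarith [hs.2])
      rwa [abs_of_nonneg hs.1] at this
  rcases le_total 0 t with h | h
  · rw [abs_of_nonneg h] at ht ⊢
    exact key hy hb t h ht
  · rw [abs_of_nonpos h] at ht ⊢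
    have := key (y := fun s => y (-s)) (y' := fun s => -y' (-s))
      (fun s => by simpa [Function.comp_def] using (hy (-s)).scomp s (hasDerivAt_neg s))
      (fun s hs => by simpa using hb (-s) (by simpa using hs)) (-t) (by linarith) ht
    simpa using this

/-- Inverse of the weight `e^{min(b p, R) - λ|s|p}`: the analyticity width `b` shrinks at speed `λ`,
and the truncation at height `R` makes every bounded function have a finite weighted norm. -/
noncomputable def invWeight (b lam R s p : ℝ) : ℝ :=
  Real.exp (-min (b * p) R) * Real.exp (lam * |s| * p)

variable {b lam R s p : ℝ}

lemma invWeight_pos : 0 < invWeight b lam R s p := by unfold invWeight; positivity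

lemma exp_neg_le_invWeight (hlam : 0 ≤ lam) (hp : 0 ≤ p) : Real.exp (-R) ≤ invWeight b lam R s p := by
  rw [invWeight, ← Real.exp_add]
  refine Real.exp_le_exp.2 ?_
  have : 0 ≤ lam * |s| * p := by positivity
  linarith [min_le_right (b * p) R]

lemma exp_le_invWeight : Real.exp (-((b - lam * |s|) * p)) ≤ invWeight b lam R s p := by
  rw [invWeight, ← Real.exp_add]
  refine Real.exp_le_exp.2 ?_
  linarith [min_le_left (b * p) R]

lemma invWeight_self : invWeight b lam (b * p) s p = Real.exp (-((b - lam * |s|) * p)) := by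
  rw [invWeight, ← Real.exp_add, min_self]
  congr 1; ring

lemma invWeight_le_of_abs_sub_le {p' D : ℝ} (hb : 0 ≤ b) (hlam : 0 ≤ lam) (hs : lam * |s| ≤ b)
    (hD : |p' - p| ≤ D) : invWeight b lam R s p' ≤ invWeight b lam R s p * Real.exp (b * D) := by
  rw [invWeight, invWeight, ← Real.exp_add, ← Real.exp_add, ← Real.exp_add]
  refine Real.exp_le_exp.2 ?_
  obtain ⟨h1, h2⟩ := abs_le.1 hD
  have hls : 0 ≤ lam * |s| := by positivity
  rcases le_total p p' with h | h
  · have e1 : min (b * p) R ≤ min (b * p') R := min_le_min_right _ (by gcongr)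
    have e2 : lam * |s| * (p' - p) ≤ b * D := mul_le_mul hs h2 (by linarith) hb
    nlinarith
  · have e1 : min (b * p) R ≤ min (b * p') R + b * D := by
      have : b * (p - p') ≤ b * D := by gcongr; linarith
      have hD0 : 0 ≤ b * D := mul_nonneg hb (by linarith)
      rcases min_cases (b * p') R with ⟨h3, _⟩ | ⟨h3, _⟩ <;> rw [h3]
      · linarith [min_le_left (b * p) R]
      · linarith [min_le_right (b * p) R]
    have e2 : lam * |s| * p' ≤ lam * |s| * p := by gcongr
    linarith

end Contraction

/-! ### Analytic bound for the Vlasov solution -/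

section Estimates

open Filter Topology

variable {d : ℕ} {Φhat : PhysSpace d → ℂ} {b T : ℝ}

lemma norm_integral_le_cPhi (hC : Integrable (cPhiIntegrand Φhat b T)) (hT : 0 ≤ T)
    {H : PhysSpace d → ℂ} {c : PhysSpace d} {B : ℝ}
    (hH : ∀ h, ‖H h‖ ≤ B * Real.exp (b * (2 * ‖h‖ * (1 + T)))) :
    ‖∫ h, Φhat h * (inner ℝ h c : ℝ) * H h‖ ≤ ‖c‖ * B * cPhi Φhat b T := by
  rw [cPhi, ← integral_const_mul]
  refine norm_integral_le_of_norm_le (hC.const_mul _) (Eventually.of_forall fun h => ?_)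
  rw [norm_mul, norm_mul, Complex.norm_real]
  calc ‖Φhat h‖ * ‖inner ℝ h c‖ * ‖H h‖
      ≤ ‖Φhat h‖ * (‖h‖ * ‖c‖) * (B * Real.exp (b * (2 * ‖h‖ * (1 + T)))) := by
        gcongr
        · exact norm_inner_le_norm _ _
        · exact hH h
    _ = _ := by
        rw [cPhiIntegrand, abs_of_nonneg hT]
        ring_nf

lemma cPhi_nonneg : 0 ≤ cPhi Φhat b T :=
  integral_nonneg fun h => by unfold cPhiIntegrand; positivity

/-- Propagation of the analytic norm along the Vlasov equation, in the moving frame. The equation is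
read as a linear one for `g(ξ, η)`, with the coefficient `g(-h, sh)` bounded by `1`. -/
theorem norm_le_of_vlasov_fourier {g : ℝ → PhysSpace d → PhysSpace d → ℂ}
    (hg1 : ∀ s ξ η, ‖g s ξ η‖ ≤ 1)
    (hg : ∀ ξ η t, HasDerivAt (fun t => g t ξ η)
      (-∫ h, Φhat h * (inner ℝ h (η + t • ξ) : ℝ) * (g t (-h) (t • h) * g t (ξ + h) (η - t • h))) t)
    (hC : Integrable (cPhiIntegrand Φhat b T)) {M lam t₁ : ℝ} (hb : 0 ≤ b) (hM : 1 ≤ M)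
    (hlam : 0 < lam) (ht₁T : t₁ ≤ T) (hlb : lam * t₁ ≤ b)
    (hK : 4 * M * ((1 + T) * cPhi Φhat b T) ≤ lam)
    (h0 : ∀ ξ η, ‖g 0 ξ η‖ ≤ M * Real.exp (-(b * (‖ξ‖ + ‖η‖))))
    {t : ℝ} (ht : |t| ≤ t₁) (ξ η : PhysSpace d) :
    ‖g t ξ η‖ ≤ M * Real.exp (-((b - lam * |t|) * (‖ξ‖ + ‖η‖))) := by
  have hT : 0 ≤ T := (abs_nonneg t).trans (ht.trans ht₁T)
  have main : ∀ R, ∀ i ∈ {i : ℝ × PhysSpace d × PhysSpace d | |i.1| ≤ t₁},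
      ‖g i.1 i.2.1 i.2.2‖ ≤ M * invWeight b lam R i.1 (‖i.2.1‖ + ‖i.2.2‖) := by
    intro R
    refine le_mul_of_forall_halving (Real.exp_pos R).le ?_ ?_
    · rintro ⟨s, ξ, η⟩ -
      refine (hg1 s ξ η).trans ?_
      have h1 := exp_neg_le_invWeight (b := b) (R := R) (s := s) hlam.le
        (add_nonneg (norm_nonneg ξ) (norm_nonneg η))
      calc (1 : ℝ) = Real.exp R * Real.exp (-R) := by rw [← Real.exp_add]; simp
        _ ≤ (M + Real.exp R) * invWeight b lam R s (‖ξ‖ + ‖η‖) := by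
          gcongr; linarith
    · rintro r hr ih ⟨t, ξ, η⟩ ht
      set p := ‖ξ‖ + ‖η‖ with hp
      have hp0 : 0 ≤ p := by positivity
      have hder : ∀ s, |s| ≤ t₁ → ‖-∫ h, Φhat h * (inner ℝ h (η + s • ξ) : ℝ)
          * (g s (-h) (s • h) * g s (ξ + h) (η - s • h))‖
          ≤ ((M + r) * ((1 + T) * cPhi Φhat b T) * Real.exp (-min (b * p) R)) * p
            * Real.exp (lam * |s| * p) := by
        intro s hs
        rw [norm_neg]
        have hsT : |s| ≤ T := hs.trans ht₁T
        have hcs : ‖η + s • ξ‖ ≤ (1 + T) * p := by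
          refine (norm_add_le _ _).trans ?_
          rw [norm_smul, Real.norm_eq_abs]
          nlinarith [norm_nonneg ξ, norm_nonneg η, abs_nonneg s,
            mul_le_mul_of_nonneg_right hsT (norm_nonneg ξ), mul_nonneg hT (norm_nonneg η)]
        refine (norm_integral_le_cPhi hC hT (B := (M + r) * invWeight b lam R s p)
          fun h => ?_).trans ?_
        · rw [norm_mul]
          have h1 := ih (s, ξ + h, η - s • h) hs
          have h2 : |(‖ξ + h‖ + ‖η - s • h‖) - p| ≤ 2 * ‖h‖ * (1 + T) := by
            have a1 := abs_norm_sub_norm_le (ξ + h) ξ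
            have a2 := abs_norm_sub_norm_le (η - s • h) η
            rw [add_sub_cancel_left] at a1
            rw [sub_sub_cancel_left, norm_neg, norm_smul, Real.norm_eq_abs] at a2
            have a3 : |s| * ‖h‖ ≤ T * ‖h‖ := by gcongr
            have a4 : 0 ≤ T * ‖h‖ := by positivity
            calc |(‖ξ + h‖ + ‖η - s • h‖) - p|
                = |(‖ξ + h‖ - ‖ξ‖) + (‖η - s • h‖ - ‖η‖)| := by rw [hp]; ring_nf
              _ ≤ _ := (abs_add_le _ _).trans (by nlinarith [norm_nonneg h])
          have h3 := invWeight_le_of_abs_sub_le (R := R) (lam := lam) (s := s) hb hlam.le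
            ((mul_le_mul_of_nonneg_left hs hlam.le).trans hlb) h2
          calc ‖g s (-h) (s • h)‖ * ‖g s (ξ + h) (η - s • h)‖
              ≤ 1 * ((M + r) * (invWeight b lam R s p
                * Real.exp (b * (2 * ‖h‖ * (1 + T))))) := by
                refine mul_le_mul (hg1 _ _ _) (h1.trans ?_) (norm_nonneg _) zero_le_one
                gcongr
            _ = _ := by ring
        · have : 0 ≤ (M + r) * invWeight b lam R s p * cPhi Φhat b T :=
            mul_nonneg (mul_nonneg (by linarith) invWeight_pos.le) cPhi_nonneg
          calc ‖η + s • ξ‖ * ((M + r) * invWeight b lam R s p) * cPhi Φhat b T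
              = ‖η + s • ξ‖ * ((M + r) * invWeight b lam R s p * cPhi Φhat b T) := by ring
            _ ≤ (1 + T) * p * ((M + r) * invWeight b lam R s p * cPhi Φhat b T) := by gcongr
            _ = _ := by rw [invWeight]; ring
      have hy := norm_le_of_norm_deriv_le_exp (hg ξ η) hlam hder (show |t| ≤ t₁ from ht)
      refine hy.trans ?_
      set X := Real.exp (lam * |t| * p) with hX
      have hX1 : 1 ≤ X := Real.one_le_exp (by positivity)
      have h0' : ‖g 0 ξ η‖ ≤ M * Real.exp (-min (b * p) R) :=
        (h0 ξ η).trans (by gcongr; exact min_le_left _ _)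
      have hK' : (1 + T) * cPhi Φhat b T / lam ≤ 1 / 4 := by
        rw [div_le_iff₀ hlam]
        have : 0 ≤ (1 + T) * cPhi Φhat b T := mul_nonneg (by linarith) cPhi_nonneg
        nlinarith
      show _ ≤ (M + r / 2) * invWeight b lam R t p
      rw [invWeight, ← hX]
      set m := Real.exp (-min (b * p) R)
      have hm : 0 < m := Real.exp_pos _
      calc ‖g 0 ξ η‖ + (M + r) * ((1 + T) * cPhi Φhat b T) * m / lam * (X - 1)
          = ‖g 0 ξ η‖ + (M + r) * m * (X - 1) * ((1 + T) * cPhi Φhat b T / lam) := by ring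
        _ ≤ M * m + (M + r) * m * (X - 1) * (1 / 4) := by
          gcongr
        _ ≤ (M + r / 2) * (m * X) := by
          have : 0 ≤ m * ((3 / 4 * M + r / 4) * (X - 1) + r / 2) := by
            have : 0 ≤ (3 / 4 * M + r / 4) * (X - 1) := mul_nonneg (by linarith) (by linarith)
            positivity
          nlinarith
  have := main (b * (‖ξ‖ + ‖η‖)) (t, ξ, η) ht
  rwa [invWeight_self] at this

end Estimates

/-! ### Comparison of the many-body and mean-field dynamics -/

section ManyBody

open Filter Topology

variable {d N : ℕ}

/-- `∑ᵢ (|ξᵢ| + |ηᵢ|)`. -/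
noncomputable def totalFreq (ξ η : Fin N → PhysSpace d) : ℝ := ∑ i, (‖ξ i‖ + ‖η i‖)

open Classical in
/-- The particles whose frequency is not zero. -/
noncomputable def activeSet (ξ η : Fin N → PhysSpace d) : Finset (Fin N) :=
  Finset.univ.filter fun i => ξ i ≠ 0 ∨ η i ≠ 0

lemma mem_activeSet {ξ η : Fin N → PhysSpace d} {i : Fin N} :
    i ∈ activeSet ξ η ↔ ξ i ≠ 0 ∨ η i ≠ 0 := by simp [activeSet]

lemma notMem_activeSet {ξ η : Fin N → PhysSpace d} {i : Fin N} :
    i ∉ activeSet ξ η ↔ ξ i = 0 ∧ η i = 0 := by simp [mem_activeSet]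

lemma totalFreq_nonneg (ξ η : Fin N → PhysSpace d) : 0 ≤ totalFreq ξ η :=
  Finset.sum_nonneg fun i _ => by positivity

lemma exchange_apply (k l i : Fin N) (h : PhysSpace d) :
    exchange k l h i = (if i = k then h else 0) - if i = l then h else 0 := by
  simp [exchange, Pi.single_apply]

lemma sum_norm_exchange_le (k l : Fin N) (h : PhysSpace d) :
    ∑ i, ‖exchange k l h i‖ ≤ 2 * ‖h‖ := by
  have : ∀ i, ‖exchange k l h i‖ ≤ (if i = k then ‖h‖ else 0) + if i = l then ‖h‖ else 0 := by
    intro i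
    rw [exchange_apply]
    refine (norm_sub_le _ _).trans_eq ?_
    split_ifs <;> simp
  refine (Finset.sum_le_sum fun i _ => this i).trans_eq ?_
  rw [Finset.sum_add_distrib]
  simp
  ring

lemma abs_totalFreq_sub_le (ξ η x y : Fin N → PhysSpace d) :
    |totalFreq (ξ + x) (η - y) - totalFreq ξ η| ≤ totalFreq x y := by
  rw [totalFreq, totalFreq, totalFreq, ← Finset.sum_sub_distrib]
  refine (Finset.abs_sum_le_sum_abs _ _).trans (Finset.sum_le_sum fun i _ => ?_)
  have a1 := abs_norm_sub_norm_le (ξ i + x i) (ξ i)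
  have a2 := abs_norm_sub_norm_le (η i - y i) (η i)
  rw [add_sub_cancel_left] at a1
  rw [sub_sub_cancel_left, norm_neg] at a2
  calc |‖(ξ + x) i‖ + ‖(η - y) i‖ - (‖ξ i‖ + ‖η i‖)|
      = |(‖ξ i + x i‖ - ‖ξ i‖) + (‖η i - y i‖ - ‖η i‖)| := by
        simp only [Pi.add_apply, Pi.sub_apply]; ring_nf
    _ ≤ _ := (abs_add_le _ _).trans (add_le_add a1 a2)

lemma totalFreq_exchange_le (k l : Fin N) (h : PhysSpace d) {s T : ℝ} (hs : |s| ≤ T) :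
    totalFreq (exchange k l h) (s • exchange k l h) ≤ 2 * ‖h‖ * (1 + T) := by
  have e : totalFreq (exchange k l h) (s • exchange k l h)
      = (1 + |s|) * ∑ i, ‖exchange k l h i‖ := by
    rw [totalFreq, Finset.mul_sum]
    refine Finset.sum_congr rfl fun i _ => ?_
    rw [Pi.smul_apply, norm_smul, Real.norm_eq_abs]; ring
  rw [e]
  have := sum_norm_exchange_le k l h
  have h2 : 0 ≤ 1 + |s| := by positivity
  calc (1 + |s|) * ∑ i, ‖exchange k l h i‖ ≤ (1 + T) * (2 * ‖h‖) := by
        gcongr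
        linarith [abs_nonneg s]
    _ = _ := by ring

lemma card_activeSet_exchange_le {ξ η : Fin N → PhysSpace d} {k : Fin N}
    (hk : k ∈ activeSet ξ η) (l : Fin N) (h : PhysSpace d) (s : ℝ) :
    (activeSet (ξ + exchange k l h) (η - s • exchange k l h)).card ≤ (activeSet ξ η).card + 1 := by
  refine (Finset.card_le_card (t := insert l (activeSet ξ η)) fun i hi => ?_).trans
    (Finset.card_insert_le _ _)
  by_contra hn
  rw [Finset.mem_insert, not_or] at hn
  have hik : i ≠ k := fun e => hn.2 (e ▸ hk)
  have hz := notMem_activeSet.1 hn.2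
  refine notMem_activeSet.2 ?_ hi
  simp [exchange_apply, hik, hn.1, hz.1, hz.2]

lemma sum_norm_le_totalFreq (ξ η : Fin N → PhysSpace d) {s T : ℝ} (hs : |s| ≤ T) :
    ∑ k, ‖η k + s • ξ k‖ ≤ (1 + T) * totalFreq ξ η := by
  have hT : 0 ≤ T := (abs_nonneg s).trans hs
  rw [totalFreq, Finset.mul_sum]
  refine Finset.sum_le_sum fun k _ => (norm_add_le _ _).trans ?_
  rw [norm_smul, Real.norm_eq_abs]
  nlinarith [norm_nonneg (ξ k), norm_nonneg (η k),
    mul_le_mul_of_nonneg_right hs (norm_nonneg (ξ k)), mul_nonneg hT (norm_nonneg (η k))]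

/-- A one-particle bound `|g(ξ, η)| ≤ M e^{-ω (|ξ| + |η|)}` with `g(0, 0) = 1` gives the bound
`M^J e^{-ω p}` for tensor powers, `J` counting only the active particles. -/
lemma norm_prod_apply_le {g : PhysSpace d → PhysSpace d → ℂ} {M ω : ℝ} (hg0 : g 0 0 = 1)
    (hg : ∀ ξ η, ‖g ξ η‖ ≤ M * Real.exp (-(ω * (‖ξ‖ + ‖η‖)))) (ξ η : Fin N → PhysSpace d) :
    ‖∏ i, g (ξ i) (η i)‖ ≤ M ^ (activeSet ξ η).card * Real.exp (-(ω * totalFreq ξ η)) := by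
  classical
  have h1 : ∀ i, ‖g (ξ i) (η i)‖ ≤ (if i ∈ activeSet ξ η then M else 1)
      * Real.exp (-(ω * (‖ξ i‖ + ‖η i‖))) := fun i => by
    split_ifs with h
    · exact hg _ _
    · obtain ⟨e1, e2⟩ := notMem_activeSet.1 h
      simp [e1, e2, hg0]
  rw [norm_prod]
  refine (Finset.prod_le_prod (fun i _ => norm_nonneg _) fun i _ => h1 i).trans_eq ?_
  rw [Finset.prod_mul_distrib, ← Real.exp_sum, Finset.sum_neg_distrib, ← Finset.mul_sum, totalFreq]
  congr 1
  rw [Finset.prod_ite_mem, Finset.univ_inter, Finset.prod_const]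

/-- The Vlasov interaction of particle `k` with an additional particle of the same law, at
exchanged frequency `h`. -/
noncomputable def meanFieldTerm (g : PhysSpace d → PhysSpace d → ℂ) (s : ℝ)
    (ξ η : Fin N → PhysSpace d) (k : Fin N) (h : PhysSpace d) : ℂ :=
  g (-h) (s • h) * (g (ξ k + h) (η k - s • h) * ∏ i ∈ Finset.univ.erase k, g (ξ i) (η i))

lemma norm_meanFieldTerm_le {g : PhysSpace d → PhysSpace d → ℂ} {M ω s : ℝ} (hM : 1 ≤ M)
    (hω : 0 ≤ ω) (hg0 : g 0 0 = 1) (hg : ∀ ξ η, ‖g ξ η‖ ≤ M * Real.exp (-(ω * (‖ξ‖ + ‖η‖))))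
    {ξ η : Fin N → PhysSpace d} {k : Fin N} (hk : k ∈ activeSet ξ η) (h : PhysSpace d) :
    ‖meanFieldTerm g s ξ η k h‖
      ≤ M ^ ((activeSet ξ η).card + 1) * Real.exp (-(ω * totalFreq ξ η)) := by
  set x : Fin N → PhysSpace d := Pi.single k h with hx
  have hxi : ∀ i ≠ k, x i = 0 := fun i hi => by simp [hx, hi]
  have e1 : g (ξ k + h) (η k - s • h) * ∏ i ∈ Finset.univ.erase k, g (ξ i) (η i)
      = ∏ i, g ((ξ + x) i) ((η - s • x) i) := by
    rw [← Finset.mul_prod_erase _ _ (Finset.mem_univ k)]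
    congr 1
    · simp [hx]
    · refine Finset.prod_congr rfl fun i hi => ?_
      simp [hxi i (Finset.ne_of_mem_erase hi)]
  have hcard : (activeSet (ξ + x) (η - s • x)).card ≤ (activeSet ξ η).card := by
    refine Finset.card_le_card fun i hi => ?_
    by_contra hn
    have hik : i ≠ k := fun e => hn (e ▸ hk)
    have hz := notMem_activeSet.1 hn
    exact notMem_activeSet.2 (by simp [hxi i hik, hz.1, hz.2]) hi
  have hfreq : totalFreq ξ η ≤ totalFreq (ξ + x) (η - s • x) + (‖-h‖ + ‖s • h‖) := by
    have h1 := (abs_le.1 (abs_totalFreq_sub_le ξ η x (s • x))).1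
    have h2 : totalFreq x (s • x) = ‖-h‖ + ‖s • h‖ := by
      rw [totalFreq, Finset.sum_eq_single k (fun i _ hi => by simp [hxi i hi]) (by simp)]
      simp [hx]
    linarith
  rw [meanFieldTerm, e1, norm_mul]
  calc _ ≤ (M * Real.exp (-(ω * (‖-h‖ + ‖s • h‖)))) * (M ^ (activeSet (ξ + x) (η - s • x)).card
        * Real.exp (-(ω * totalFreq (ξ + x) (η - s • x)))) :=
        mul_le_mul (hg _ _) (norm_prod_apply_le hg0 hg _ _) (norm_nonneg _) (by positivity)
    _ = M ^ ((activeSet (ξ + x) (η - s • x)).card + 1)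
        * Real.exp (-(ω * (totalFreq (ξ + x) (η - s • x) + (‖-h‖ + ‖s • h‖)))) := by
        rw [show -(ω * (totalFreq (ξ + x) (η - s • x) + (‖-h‖ + ‖s • h‖)))
          = -(ω * (‖-h‖ + ‖s • h‖)) + -(ω * totalFreq (ξ + x) (η - s • x)) by ring, Real.exp_add]
        ring
    _ ≤ _ := by
        gcongr

/-- If particle `l` is not active, its exchange with `k` is exactly the mean-field interaction. -/
lemma prod_exchange_eq_meanFieldTerm {g : PhysSpace d → PhysSpace d → ℂ} {s : ℝ} (hg0 : g 0 0 = 1)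
    {ξ η : Fin N → PhysSpace d} {k l : Fin N} (hk : k ∈ activeSet ξ η) (hl : l ∉ activeSet ξ η)
    (h : PhysSpace d) :
    ∏ i, g ((ξ + exchange k l h) i) ((η - s • exchange k l h) i) = meanFieldTerm g s ξ η k h := by
  have hlk : l ≠ k := fun e => hl (e ▸ hk)
  have hz := notMem_activeSet.1 hl
  have hl' : l ∈ Finset.univ.erase k := by simp [hlk]
  rw [meanFieldTerm, ← Finset.mul_prod_erase _ _ (Finset.mem_univ k),
    ← Finset.mul_prod_erase _ _ hl', ← Finset.mul_prod_erase (Finset.univ.erase k) (fun i =>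
      g (ξ i) (η i)) hl', hz.1, hz.2, hg0]
  have e : ∏ i ∈ (Finset.univ.erase k).erase l, g ((ξ + exchange k l h) i)
      ((η - s • exchange k l h) i) = ∏ i ∈ (Finset.univ.erase k).erase l, g (ξ i) (η i) := by
    refine Finset.prod_congr rfl fun i hi => ?_
    have h1 := Finset.ne_of_mem_erase hi
    have h2 := Finset.ne_of_mem_erase (Finset.mem_of_mem_erase hi)
    simp [exchange_apply, h1, h2]
  rw [e]
  simp [exchange_apply, hlk, hlk.symm, hz.1, hz.2]
  ring

variable {Φhat : PhysSpace d → ℂ} {b T : ℝ}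

lemma integrable_mul_inner_mul (hC : Integrable (cPhiIntegrand Φhat b T)) (hb : 0 ≤ b)
    (hΦm : AEStronglyMeasurable Φhat) {H : PhysSpace d → ℂ} (hH : Continuous H)
    (hH1 : ∀ h, ‖H h‖ ≤ 1) (c : PhysSpace d) :
    Integrable fun h => Φhat h * (inner ℝ h c : ℝ) * H h := by
  refine (hC.mul_const ‖c‖).mono' ((hΦm.mul (Continuous.aestronglyMeasurable (by fun_prop))).mul
    hH.aestronglyMeasurable) (Eventually.of_forall fun h => ?_)
  rw [norm_mul, norm_mul, Complex.norm_real]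
  have h1 : 1 ≤ Real.exp (2 * b * ‖h‖ * (1 + |T|)) := Real.one_le_exp (by positivity)
  calc ‖Φhat h‖ * ‖inner ℝ h c‖ * ‖H h‖ ≤ ‖Φhat h‖ * (‖h‖ * ‖c‖) * 1 := by
        gcongr
        · exact norm_inner_le_norm _ _
        · exact hH1 h
    _ ≤ ‖Φhat h‖ * (‖h‖ * ‖c‖) * Real.exp (2 * b * ‖h‖ * (1 + |T|)) := by gcongr
    _ = _ := by rw [cPhiIntegrand]; ring

/-- The mean-field estimate in the moving frame. The difference between the `N`-body transform and
the tensor power of the Vlasov transform, weighted by `(J + 1) M^J` with `J` the number of active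
particles, contracts up to a source of size `1 / N` due to interactions among active particles. -/
theorem norm_sub_prod_le {g : ℝ → PhysSpace d → PhysSpace d → ℂ}
    {G : ℝ → (Fin N → PhysSpace d) → (Fin N → PhysSpace d) → ℂ} (hN : 1 ≤ N)
    (hΦm : AEStronglyMeasurable Φhat)
    (hg1 : ∀ s ξ η, ‖g s ξ η‖ ≤ 1) (hg0 : ∀ s, g s 0 0 = 1)
    (hgc : ∀ s, Continuous fun p : PhysSpace d × PhysSpace d => g s p.1 p.2)
    (hg : ∀ ξ η t, HasDerivAt (fun t => g t ξ η)
      (-∫ h, Φhat h * (inner ℝ h (η + t • ξ) : ℝ) * (g t (-h) (t • h) * g t (ξ + h) (η - t • h))) t)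
    (hG1 : ∀ s ξ η, ‖G s ξ η‖ ≤ 1)
    (hGc : ∀ s, Continuous fun p : (Fin N → PhysSpace d) × (Fin N → PhysSpace d) => G s p.1 p.2)
    (hG : ∀ ξ η t, HasDerivAt (fun t => G t ξ η)
      (-((1 / (N : ℝ) : ℝ) * ∑ k, ∑ l, ∫ h, Φhat h * (inner ℝ h (η k + t • ξ k) : ℝ)
        * G t (ξ + exchange k l h) (η - t • exchange k l h))) t)
    (hC : Integrable (cPhiIntegrand Φhat b T)) {M lam t₁ τ : ℝ} (hb : 0 ≤ b) (hM : 1 ≤ M)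
    (hlam : 0 < lam) (ht₁T : t₁ ≤ T) (hlb : lam * t₁ ≤ b) (hτ0 : 0 ≤ τ) (hτ1 : τ ≤ 1)
    (hK : 4 * M * ((1 + T) * cPhi Φhat b T) = τ * lam)
    (h0 : ∀ ξ η, ‖g 0 ξ η‖ ≤ M * Real.exp (-(b * (‖ξ‖ + ‖η‖))))
    (hG0 : ∀ ξ η, G 0 ξ η = ∏ i, g 0 (ξ i) (η i))
    {t : ℝ} (ht : |t| ≤ t₁) (ξ η : Fin N → PhysSpace d) :
    ‖G t ξ η - ∏ i, g t (ξ i) (η i)‖ ≤ τ / N * ((((activeSet ξ η).card : ℝ) + 1)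
      * M ^ (activeSet ξ η).card * Real.exp (-((b - lam * |t|) * totalFreq ξ η))) := by
  have hT : 0 ≤ T := (abs_nonneg t).trans (ht.trans ht₁T)
  have hNpos : (0 : ℝ) < N := by exact_mod_cast hN
  have hM0 : 0 ≤ M := zero_le_one.trans hM
  have hls : ∀ s, |s| ≤ t₁ → lam * |s| ≤ b := fun s hs =>
    (mul_le_mul_of_nonneg_left hs hlam.le).trans hlb
  have hgb : ∀ s, |s| ≤ t₁ → ∀ ξ η,
      ‖g s ξ η‖ ≤ M * Real.exp (-((b - lam * |s|) * (‖ξ‖ + ‖η‖))) := fun s hs ξ η =>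
    norm_le_of_vlasov_fourier hg1 hg hC hb hM hlam ht₁T hlb
      (hK.trans_le (mul_le_of_le_one_left hlam.le hτ1)) h0 hs ξ η
  set K := (1 + T) * cPhi Φhat b T with hKdef
  have hK0 : 0 ≤ K := mul_nonneg (by linarith) cPhi_nonneg
  set J : (Fin N → PhysSpace d) → (Fin N → PhysSpace d) → ℝ := fun ξ η =>
    ((activeSet ξ η).card : ℝ) with hJ
  have hJ0 : ∀ ξ η, 0 ≤ J ξ η := fun ξ η => Nat.cast_nonneg _
  -- time derivative of the error
  have hE : ∀ ξ η t, HasDerivAt (fun t => G t ξ η - ∏ i, g t (ξ i) (η i))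
      (-((1 / (N : ℝ) : ℝ) * ∑ k, ∑ l, ∫ h, Φhat h * (inner ℝ h (η k + t • ξ k) : ℝ)
        * (G t (ξ + exchange k l h) (η - t • exchange k l h)
          - meanFieldTerm (g t) t ξ η k h))) t := by
    intro ξ η t
    have hprod := HasDerivAt.fun_finsetProd (u := Finset.univ)
      (fun i _ => hg (ξ i) (η i) t)
    refine ((hG ξ η t).sub hprod).congr_deriv ?_
    have hmf : ∀ k, (∏ j ∈ Finset.univ.erase k, g t (ξ j) (η j)) • (-∫ h, Φhat h
        * (inner ℝ h (η k + t • ξ k) : ℝ) * (g t (-h) (t • h) * g t (ξ k + h) (η k - t • h)))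
        = -∫ h, Φhat h * (inner ℝ h (η k + t • ξ k) : ℝ) * meanFieldTerm (g t) t ξ η k h := by
      intro k
      rw [smul_neg, smul_eq_mul, ← integral_const_mul]
      congr 1
      refine integral_congr_ae (Eventually.of_forall fun h => ?_)
      simp only [meanFieldTerm]
      ring
    have hsplit : ∀ k l, ∫ h, Φhat h * (inner ℝ h (η k + t • ξ k) : ℝ)
        * (G t (ξ + exchange k l h) (η - t • exchange k l h) - meanFieldTerm (g t) t ξ η k h)
        = (∫ h, Φhat h * (inner ℝ h (η k + t • ξ k) : ℝ)
          * G t (ξ + exchange k l h) (η - t • exchange k l h))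
        - ∫ h, Φhat h * (inner ℝ h (η k + t • ξ k) : ℝ) * meanFieldTerm (g t) t ξ η k h := by
      intro k l
      rw [← integral_sub]
      · simp_rw [mul_sub]
      · refine integrable_mul_inner_mul hC hb hΦm ?_ (fun h => hG1 _ _ _) _
        have := continuous_exchange (d := d) k l
        exact (hGc t).comp (by fun_prop : Continuous fun h =>
          (ξ + exchange k l h, η - t • exchange k l h))
      · refine integrable_mul_inner_mul hC hb hΦm ?_ (fun h => ?_) _
        · unfold meanFieldTerm
          exact ((hgc t).comp (by fun_prop : Continuous fun h : PhysSpace d => (-h, t • h))).mul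
            (((hgc t).comp (by fun_prop : Continuous fun h : PhysSpace d =>
              (ξ k + h, η k - t • h))).mul continuous_const)
        · rw [meanFieldTerm, norm_mul, norm_mul, norm_prod]
          exact mul_le_one₀ (hg1 _ _ _) (by positivity) (mul_le_one₀ (hg1 _ _ _) (by positivity)
            (Finset.prod_le_one (fun _ _ => norm_nonneg _) fun _ _ => hg1 _ _ _))
    simp_rw [hmf, hsplit, Finset.sum_sub_distrib, Finset.sum_neg_distrib]
    simp only [Finset.sum_const, Finset.card_univ, Fintype.card_fin, nsmul_eq_mul]
    rw [← Finset.mul_sum]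
    have : (N : ℂ) ≠ 0 := by exact_mod_cast hNpos.ne'
    push_cast
    field_simp
    ring
  have main : ∀ R, ∀ i ∈ {i : ℝ × (Fin N → PhysSpace d) × (Fin N → PhysSpace d) | |i.1| ≤ t₁},
      ‖G i.1 i.2.1 i.2.2 - ∏ j, g i.1 (i.2.1 j) (i.2.2 j)‖
        ≤ τ / N * ((J i.2.1 i.2.2 + 1) * M ^ (activeSet i.2.1 i.2.2).card
          * invWeight b lam R i.1 (totalFreq i.2.1 i.2.2)) := by
    intro R
    -- `2 e^R` bounds the weighted error a priori: the error is at most `2` and the weight at least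
    -- `e^{-R}`; `τ / N` is the limit of the iteration `c ↦ c / 2 + τ / (2N)` carried out below
    refine le_mul_of_forall_halving (r₀ := 2 * Real.exp R) (by positivity) ?_ ?_
    · rintro ⟨s, ξ, η⟩ -
      have h2 : ‖G s ξ η - ∏ j, g s (ξ j) (η j)‖ ≤ 2 := by
        refine (norm_sub_le _ _).trans ?_
        have : ‖∏ j, g s (ξ j) (η j)‖ ≤ 1 := by
          rw [norm_prod]
          exact Finset.prod_le_one (fun _ _ => norm_nonneg _) fun _ _ => hg1 _ _ _
        linarith [hG1 s ξ η]
      refine h2.trans ?_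
      have h1 := exp_neg_le_invWeight (b := b) (R := R) (s := s) hlam.le (totalFreq_nonneg ξ η)
      calc (2 : ℝ) = (0 + 2 * Real.exp R) * ((0 + 1) * 1 * Real.exp (-R)) := by
            rw [zero_add, zero_add, one_mul, one_mul, mul_assoc, ← Real.exp_add]; simp
        _ ≤ _ := by
          have := hJ0 ξ η
          have : 1 ≤ M ^ (activeSet ξ η).card := one_le_pow₀ hM
          show _ ≤ (τ / N + 2 * Real.exp R) * ((J ξ η + 1) * M ^ (activeSet ξ η).card
            * invWeight b lam R s (totalFreq ξ η))
          gcongr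
          positivity
    · rintro r hr ih ⟨t, ξ, η⟩ ht
      set p := totalFreq ξ η with hp
      have hp0 : 0 ≤ p := totalFreq_nonneg ξ η
      set n := (activeSet ξ η).card with hn
      have hMn : 0 ≤ M ^ n := pow_nonneg hM0 n
      set c := τ / N + r with hc
      have hc0 : 0 ≤ c := by positivity
      have hder : ∀ s, |s| ≤ t₁ → ‖-((1 / (N : ℝ) : ℝ) * ∑ k, ∑ l, ∫ h, Φhat h
          * (inner ℝ h (η k + s • ξ k) : ℝ) * (G s (ξ + exchange k l h) (η - s • exchange k l h)
            - meanFieldTerm (g s) s ξ η k h))‖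
          ≤ (K * M * ((J ξ η + 1) * M ^ n) * (2 * c + 2 / N) * Real.exp (-min (b * p) R)) * p
            * Real.exp (lam * |s| * p) := by
        intro s hs
        have hsT : |s| ≤ T := hs.trans ht₁T
        set W := invWeight b lam R s p with hW
        have hW0 : 0 ≤ W := invWeight_pos.le
        have hω : 0 ≤ b - lam * |s| := by linarith [hls s hs]
        classical
        -- the contribution of one pair
        have hpair : ∀ k l, ‖∫ h, Φhat h * (inner ℝ h (η k + s • ξ k) : ℝ)
            * (G s (ξ + exchange k l h) (η - s • exchange k l h)
              - meanFieldTerm (g s) s ξ η k h)‖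
            ≤ ‖η k + s • ξ k‖ * (M ^ (n + 1) * W * (c * (J ξ η + 2)
              + if l ∈ activeSet ξ η then 2 else 0)) * cPhi Φhat b T := by
          intro k l
          by_cases hk : k ∈ activeSet ξ η
          swap
          · obtain ⟨e1, e2⟩ := notMem_activeSet.1 hk
            simp [e1, e2]
          refine norm_integral_le_cPhi hC hT fun h => ?_
          set ξ' := ξ + exchange k l h with hξ'
          set η' := η - s • exchange k l h with hη'
          have hcard : (activeSet ξ' η').card ≤ n + 1 := card_activeSet_exchange_le hk l h s
          have hW' : invWeight b lam R s (totalFreq ξ' η')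
              ≤ W * Real.exp (b * (2 * ‖h‖ * (1 + T))) :=
            invWeight_le_of_abs_sub_le hb hlam.le (hls s hs)
              ((abs_totalFreq_sub_le _ _ _ _).trans (totalFreq_exchange_le k l h hsT))
          have hpow : M ^ (activeSet ξ' η').card ≤ M ^ (n + 1) := pow_le_pow_right₀ hM hcard
          have hJ' : J ξ' η' + 1 ≤ J ξ η + 2 := by
            have : ((activeSet ξ' η').card : ℝ) ≤ (n : ℝ) + 1 := by exact_mod_cast hcard
            simp only [hJ, ← hn]; linarith
          -- the propagated error
          have hA : ‖G s ξ' η' - ∏ j, g s (ξ' j) (η' j)‖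
              ≤ M ^ (n + 1) * W * (c * (J ξ η + 2)) * Real.exp (b * (2 * ‖h‖ * (1 + T))) := by
            refine (ih (s, ξ', η') hs).trans ?_
            calc c * ((J ξ' η' + 1) * M ^ (activeSet ξ' η').card
                  * invWeight b lam R s (totalFreq ξ' η'))
                ≤ c * ((J ξ η + 2) * M ^ (n + 1)
                  * (W * Real.exp (b * (2 * ‖h‖ * (1 + T))))) := by
                  have := hJ0 ξ η
                  have : 0 ≤ invWeight b lam R s (totalFreq ξ' η') := invWeight_pos.le
                  gcongr
              _ = _ := by ring
          -- the source, present only if both particles are active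
          have hB : ‖∏ j, g s (ξ' j) (η' j) - meanFieldTerm (g s) s ξ η k h‖
              ≤ M ^ (n + 1) * W * (if l ∈ activeSet ξ η then 2 else 0)
                * Real.exp (b * (2 * ‖h‖ * (1 + T))) := by
            split_ifs with hl
            · have h1 : ‖∏ j, g s (ξ' j) (η' j)‖
                  ≤ M ^ (n + 1) * (W * Real.exp (b * (2 * ‖h‖ * (1 + T)))) := by
                refine (norm_prod_apply_le (hg0 s) (hgb s hs) ξ' η').trans ?_
                gcongr
                exact exp_le_invWeight.trans hW'
              have h2 : ‖meanFieldTerm (g s) s ξ η k h‖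
                  ≤ M ^ (n + 1) * (W * Real.exp (b * (2 * ‖h‖ * (1 + T)))) := by
                refine (norm_meanFieldTerm_le hM hω (hg0 s) (hgb s hs) hk h).trans ?_
                gcongr
                refine exp_le_invWeight.trans (le_mul_of_one_le_right hW0 ?_)
                exact Real.one_le_exp (by positivity)
              refine (norm_sub_le _ _).trans ((add_le_add h1 h2).trans_eq ?_)
              ring
            · rw [prod_exchange_eq_meanFieldTerm (hg0 s) hk hl h]
              simp
          calc _ = ‖(G s ξ' η' - ∏ j, g s (ξ' j) (η' j))
                + (∏ j, g s (ξ' j) (η' j) - meanFieldTerm (g s) s ξ η k h)‖ := by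
                rw [sub_add_sub_cancel]
            _ ≤ _ := (norm_add_le _ _).trans ((add_le_add hA hB).trans_eq (by ring))
        rw [norm_neg, norm_mul, Complex.norm_real, Real.norm_of_nonneg (by positivity)]
        have hJn : J ξ η = n := rfl
        have hn0 : (0 : ℝ) ≤ n := Nat.cast_nonneg _
        have hC0 : 0 ≤ cPhi Φhat b T := cPhi_nonneg
        calc _ ≤ 1 / (N : ℝ) * ∑ k, ∑ l, ‖η k + s • ξ k‖ * (M ^ (n + 1) * W * (c * (J ξ η + 2)
              + if l ∈ activeSet ξ η then 2 else 0)) * cPhi Φhat b T := by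
              gcongr
              exact norm_sum_le_of_le _ fun k _ => norm_sum_le_of_le _ fun l _ => hpair k l
          _ = (∑ k, ‖η k + s • ξ k‖) * (M ^ (n + 1) * W * (c * (J ξ η + 2) + 2 * n / N)
              * cPhi Φhat b T) := by
              rw [Finset.sum_mul, Finset.mul_sum]
              refine Finset.sum_congr rfl fun k _ => ?_
              rw [← Finset.sum_mul, ← Finset.mul_sum, ← Finset.mul_sum, Finset.sum_add_distrib,
                Finset.sum_ite_mem, Finset.univ_inter]
              simp only [Finset.sum_const, Finset.card_univ, Fintype.card_fin, nsmul_eq_mul, ← hn]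
              field_simp
          _ ≤ ((1 + T) * p) * (M ^ (n + 1) * W * ((J ξ η + 1) * (2 * c + 2 / N))
              * cPhi Φhat b T) := by
              have h3 : c * (J ξ η + 2) + 2 * n / N ≤ (J ξ η + 1) * (2 * c + 2 / N) := by
                rw [hJn]
                have : 0 ≤ c * n + 2 / N := by positivity
                have e : ((n : ℝ) + 1) * (2 * c + 2 / N) - (c * (n + 2) + 2 * n / N)
                  = c * n + 2 / N := by ring
                linarith
              have h4 := sum_norm_le_totalFreq ξ η hsT
              have h5 : 0 ≤ c * (J ξ η + 2) + 2 * n / N := by rw [hJn]; positivity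
              gcongr
          _ = _ := by rw [hW, invWeight, hKdef]; ring
      have hy := norm_le_of_norm_deriv_le_exp (hE ξ η) hlam hder (show |t| ≤ t₁ from ht)
      refine hy.trans ?_
      simp only [hG0, sub_self, norm_zero, zero_add]
      show _ ≤ (τ / N + r / 2) * ((J ξ η + 1) * M ^ n * invWeight b lam R t p)
      rw [invWeight]
      set m := Real.exp (-min (b * p) R)
      set X := Real.exp (lam * |t| * p)
      have hKM : K * M / lam = τ / 4 := by
        rw [div_eq_iff hlam.ne']; linarith
      have hJ1 : 0 ≤ J ξ η + 1 := by linarith [hJ0 ξ η]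
      have hX : X - 1 ≤ X := by linarith
      calc K * M * ((J ξ η + 1) * M ^ n) * (2 * c + 2 / N) * m / lam * (X - 1)
          = (K * M / lam) * (2 * c + 2 / N) * ((J ξ η + 1) * M ^ n * m) * (X - 1) := by ring
        _ ≤ (K * M / lam) * (2 * c + 2 / N) * ((J ξ η + 1) * M ^ n * m) * X := by gcongr
        _ = (τ * c / 2 + τ / N / 2) * ((J ξ η + 1) * M ^ n * (m * X)) := by rw [hKM]; ring
        _ ≤ _ := by
          have : τ * c ≤ c := mul_le_of_le_one_left hc0 hτ1
          refine mul_le_mul_of_nonneg_right ?_ (by positivity)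
          linarith
  -- at the given frequency the truncation at `R = b p` is inactive
  have := main (b * totalFreq ξ η) (t, ξ, η) ht
  rwa [invWeight_self] at this

end ManyBody

/-! ### Transforms of tensor powers and marginals -/

section TensorMarginal

open Filter Topology

variable {d : ℕ}

lemma movingFourierOne_eq (f : ℝ → PhysSpace d × PhysSpace d → ℝ) (t : ℝ) (ξ η : PhysSpace d) :
    movingFourierOne f t ξ (η - t • ξ) = symplecticFourierOne (f t) ξ η := by
  rw [movingFourierOne, movingFourier, symplecticFourierOne]
  refine integral_congr_ae (Eventually.of_forall fun z => ?_)
  simp only [planeWave, innerSL_apply_apply]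
  rw [mul_comm, inner_sub_left, real_inner_smul_left, real_inner_comm z.1 ξ, real_inner_comm z.2 η]
  congr 6
  ring

lemma movingFourierN_eq {n : ℕ} (F : ℝ → PhaseSpace d n → ℝ) (t : ℝ) (ξ η : Fin n → PhysSpace d) :
    movingFourierN F t ξ (η - t • ξ) = symplecticFourier (F t) ξ η := by
  rw [movingFourierN, movingFourier, symplecticFourier]
  refine integral_congr_ae (Eventually.of_forall fun z => ?_)
  simp only [planeWave, map_sub, map_smul, sub_apply, smul_apply, smul_eq_mul, sub_add_cancel]
  rw [mul_comm, pairing_apply, pairing_apply, ← Finset.sum_sub_distrib]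
  simp_rw [real_inner_comm]

lemma symplecticFourierOne_zero {g : PhysSpace d × PhysSpace d → ℝ} (hg : IsProbDensity g) :
    symplecticFourierOne g 0 0 = 1 := by
  simp only [symplecticFourierOne, inner_zero_right, sub_self, Complex.ofReal_zero, mul_zero,
    Complex.exp_zero, one_mul]
  rw [integral_complex_ofReal, hg.integral_eq_one, Complex.ofReal_one]

lemma norm_symplecticFourierOne_le {g : PhysSpace d × PhysSpace d → ℝ} {b : ℝ}
    (hg : analyticNormOne b g < ⊤) (ξ η : PhysSpace d) :
    ‖symplecticFourierOne g ξ η‖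
      ≤ (analyticNormOne b g).toReal * Real.exp (-(b * (‖ξ‖ + ‖η‖))) := by
  have h1 : ENNReal.ofReal (‖symplecticFourierOne g ξ η‖ * Real.exp (b * (‖ξ‖ + ‖η‖)))
      ≤ analyticNormOne b g :=
    le_iSup₂ (f := fun ξ η : PhysSpace d =>
      ENNReal.ofReal (‖symplecticFourierOne g ξ η‖ * Real.exp (b * (‖ξ‖ + ‖η‖)))) ξ η
  have h2 := (ENNReal.ofReal_le_iff_le_toReal hg.ne).1 h1
  rw [Real.exp_neg, ← div_eq_mul_inv, le_div_iff₀ (Real.exp_pos _)]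
  exact h2

lemma one_le_analyticNormOne {g : PhysSpace d × PhysSpace d → ℝ} {b : ℝ} (hp : IsProbDensity g)
    (hg : analyticNormOne b g < ⊤) : 1 ≤ (analyticNormOne b g).toReal := by
  simpa [symplecticFourierOne_zero hp] using norm_symplecticFourierOne_le hg 0 0

lemma symplecticFourier_tensorPow (n : ℕ) (g : PhysSpace d × PhysSpace d → ℝ)
    (ξ η : Fin n → PhysSpace d) :
    symplecticFourier (tensorPow n g) ξ η = ∏ i, symplecticFourierOne g (ξ i) (η i) := by
  have hmp := volume_measurePreserving_arrowProdEquivProdArrow (PhysSpace d) (PhysSpace d) (Fin n)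
  rw [symplecticFourier, ← hmp.integral_comp', ]
  simp_rw [symplecticFourierOne]
  rw [← integral_fintype_prod_volume_eq_prod (E := fun _ : Fin n => PhysSpace d × PhysSpace d)
    (f := fun i z => Complex.exp (Complex.I * ((inner ℝ z.1 (ξ i) - inner ℝ z.2 (η i) : ℝ) : ℂ))
      * (g z : ℂ))]
  refine integral_congr_ae (Eventually.of_forall fun z => ?_)
  simp only [MeasurableEquiv.arrowProdEquivProdArrow, MeasurableEquiv.coe_mk,
    Equiv.arrowProdEquivProdArrow_apply, tensorPow]
  rw [Complex.ofReal_sum, Finset.mul_sum, Complex.exp_sum, Complex.ofReal_prod,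
    ← Finset.prod_mul_distrib]

lemma integrable_tensorPow (n : ℕ) {g : PhysSpace d × PhysSpace d → ℝ} (hg : Integrable g) :
    Integrable (tensorPow n g) := by
  have hmp := volume_measurePreserving_arrowProdEquivProdArrow (PhysSpace d) (PhysSpace d) (Fin n)
  rw [← hmp.integrable_comp_emb (MeasurableEquiv.measurableEmbedding _)]
  exact Integrable.fintype_prod (f := fun (_ : Fin n) => g) (fun _ => hg)

/-! ### Marginals -/

/-- The indices `0, …, j - 1` and `j, …, N - 1`. -/
def splitIndex {j N : ℕ} (h : j ≤ N) : Fin j ⊕ Fin (N - j) ≃ Fin N :=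
  finSumFinEquiv.trans (finCongr (Nat.add_sub_of_le h))

lemma joinParticles_inl {j N : ℕ} (h : j ≤ N) (x : Fin j → PhysSpace d)
    (y : Fin (N - j) → PhysSpace d) (i : Fin j) :
    joinParticles x y (splitIndex h (.inl i)) = x i := by
  simp [joinParticles, splitIndex]

lemma joinParticles_inr {j N : ℕ} (h : j ≤ N) (x : Fin j → PhysSpace d)
    (y : Fin (N - j) → PhysSpace d) (i : Fin (N - j)) :
    joinParticles x y (splitIndex h (.inr i)) = y i := by
  simp [joinParticles, splitIndex]

-- needed for the measure on products of phase spaces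
set_option synthInstance.maxSize 1000

/-- Concatenation of a configuration of `j` and one of `N - j` particles. -/
def joinPhase (d : ℕ) {j N : ℕ} (h : j ≤ N) :
    PhaseSpace d j × PhaseSpace d (N - j) ≃ᵐ PhaseSpace d N :=
  (((MeasurableEquiv.arrowProdEquivProdArrow (PhysSpace d) (PhysSpace d) (Fin j)).symm.prodCongr
    (MeasurableEquiv.arrowProdEquivProdArrow (PhysSpace d) (PhysSpace d) (Fin (N - j))).symm).trans
    ((MeasurableEquiv.sumPiEquivProdPi (fun _ : Fin j ⊕ Fin (N - j) =>
      PhysSpace d × PhysSpace d)).symm.trans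
      (MeasurableEquiv.piCongrLeft (fun _ : Fin N => PhysSpace d × PhysSpace d)
        (splitIndex h)))).trans
    (MeasurableEquiv.arrowProdEquivProdArrow (PhysSpace d) (PhysSpace d) (Fin N))

lemma joinPhase_apply {j N : ℕ} (h : j ≤ N) (p : PhaseSpace d j × PhaseSpace d (N - j)) :
    joinPhase d h p = (joinParticles p.1.1 p.2.1, joinParticles p.1.2 p.2.2) := by
  have key : ∀ s, ((joinPhase d h p).1 (splitIndex h s), (joinPhase d h p).2 (splitIndex h s))
      = (joinParticles p.1.1 p.2.1 (splitIndex h s), joinParticles p.1.2 p.2.2 (splitIndex h s)) := by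
    intro s
    have e : ((joinPhase d h p).1 (splitIndex h s), (joinPhase d h p).2 (splitIndex h s))
        = MeasurableEquiv.piCongrLeft (fun _ : Fin N => PhysSpace d × PhysSpace d) (splitIndex h)
          ((MeasurableEquiv.sumPiEquivProdPi (fun _ : Fin j ⊕ Fin (N - j) =>
            PhysSpace d × PhysSpace d)).symm (fun i => (p.1.1 i, p.1.2 i), fun i => (p.2.1 i, p.2.2 i)))
          (splitIndex h s) := rfl
    rw [e, MeasurableEquiv.piCongrLeft_apply_apply]
    rcases s with i | i
    · rw [joinParticles_inl, joinParticles_inl]; rfl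
    · rw [joinParticles_inr, joinParticles_inr]; rfl
  refine Prod.ext (funext fun i => ?_) (funext fun i => ?_)
  · have := key ((splitIndex h).symm i)
    rw [Equiv.apply_symm_apply] at this
    exact congrArg Prod.fst this
  · have := key ((splitIndex h).symm i)
    rw [Equiv.apply_symm_apply] at this
    exact congrArg Prod.snd this

lemma measurePreserving_joinPhase {j N : ℕ} (h : j ≤ N) :
    MeasurePreserving (joinPhase d h)
      ((volume : Measure (PhaseSpace d j)).prod (volume : Measure (PhaseSpace d (N - j))))
      (volume : Measure (PhaseSpace d N)) := by
  have a := fun n => volume_measurePreserving_arrowProdEquivProdArrow (PhysSpace d) (PhysSpace d)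
    (Fin n)
  have h1 := ((a j).symm _).prod ((a (N - j)).symm _)
  have h2 := volume_measurePreserving_sumPiEquivProdPi_symm (fun _ : Fin j ⊕ Fin (N - j) =>
    PhysSpace d × PhysSpace d)
  have h3 := volume_measurePreserving_piCongrLeft (fun _ : Fin N => PhysSpace d × PhysSpace d)
    (splitIndex h)
  exact (a N).comp ((h3.comp h2).comp h1)

lemma integrable_marginal {j N : ℕ} (h : j ≤ N) {F : PhaseSpace d N → ℝ} (hF : Integrable F) :
    Integrable (marginal j F) := by
  have h1 : Integrable fun p => F (joinPhase d h p) :=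
    ((measurePreserving_joinPhase h).integrable_comp_emb
      (MeasurableEquiv.measurableEmbedding _)).2 hF
  simp_rw [joinPhase_apply] at h1
  exact h1.integral_prod_left

lemma symplecticFourier_marginal {j N : ℕ} (h : j ≤ N) {F : PhaseSpace d N → ℝ}
    (hF : Integrable F) (ξ η : Fin j → PhysSpace d) :
    symplecticFourier (marginal j F) ξ η
      = symplecticFourier F (joinParticles ξ 0) (joinParticles η 0) := by
  have hint : Integrable fun z : PhaseSpace d N => Complex.exp (Complex.I *
      ((∑ i, (inner ℝ (z.1 i) (joinParticles ξ 0 i) - inner ℝ (z.2 i) (joinParticles η 0 i)) : ℝ)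
        : ℂ)) * (F z : ℂ) := by
    refine hF.ofReal.bdd_mul (c := 1) (Continuous.aestronglyMeasurable (by fun_prop))
      (Eventually.of_forall fun z => ?_)
    rw [mul_comm, Complex.norm_exp_ofReal_mul_I]
  have h1 := ((measurePreserving_joinPhase h).integrable_comp_emb
      (MeasurableEquiv.measurableEmbedding _)).2 hint
  rw [symplecticFourier, symplecticFourier, ← (measurePreserving_joinPhase h).integral_comp']
  simp only [Function.comp_def, joinPhase_apply] at h1 ⊢
  have hsum : ∀ p : PhaseSpace d j × PhaseSpace d (N - j),
      ∑ i, (inner ℝ (joinParticles p.1.1 p.2.1 i) (joinParticles ξ 0 i)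
        - inner ℝ (joinParticles p.1.2 p.2.2 i) (joinParticles η 0 i))
      = ∑ i, (inner ℝ (p.1.1 i) (ξ i) - inner ℝ (p.1.2 i) (η i)) := by
    intro p
    rw [← (splitIndex h).sum_comp, Fintype.sum_sum_type]
    simp [joinParticles_inl, joinParticles_inr]
  simp_rw [hsum] at h1 ⊢
  rw [integral_prod _ h1]
  refine integral_congr_ae (Eventually.of_forall fun z => ?_)
  simp only [marginal]
  rw [integral_const_mul, integral_complex_ofReal]

lemma totalFreq_joinParticles {j N : ℕ} (h : j ≤ N) (ξ η : Fin j → PhysSpace d) :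
    totalFreq (joinParticles ξ (0 : Fin (N - j) → PhysSpace d)) (joinParticles η 0)
      = totalFreq ξ η := by
  rw [totalFreq, ← (splitIndex h).sum_comp, Fintype.sum_sum_type]
  simp [joinParticles_inl, joinParticles_inr, totalFreq]

lemma card_activeSet_joinParticles_le {j N : ℕ} (h : j ≤ N) (ξ η : Fin j → PhysSpace d) :
    (activeSet (joinParticles ξ (0 : Fin (N - j) → PhysSpace d)) (joinParticles η 0)).card ≤ j := by
  classical
  refine (Finset.card_le_card (t := Finset.univ.image fun i : Fin j => splitIndex h (.inl i))
    fun i hi => ?_).trans (Finset.card_image_le.trans (by simp))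
  obtain ⟨s, rfl⟩ := (splitIndex h).surjective i
  rcases s with s | s
  · simp
  · simp [mem_activeSet, joinParticles_inr] at hi

lemma joinParticles_sub_smul {j N : ℕ} (h : j ≤ N) (ξ η : Fin j → PhysSpace d) (t : ℝ) :
    joinParticles (N := N) (η - t • ξ) 0 = joinParticles η 0 - t • joinParticles ξ 0 := by
  funext i
  obtain ⟨s, rfl⟩ := (splitIndex h).surjective i
  rcases s with s | s <;> simp [joinParticles_inl, joinParticles_inr]

end TensorMarginal

/-! ### Estimate for the marginals -/

section Estimate

open Filter Topology

variable {d : ℕ} {Φ : PhysSpace d → ℝ} {Φhat : PhysSpace d → ℂ}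

/-- The error bound in the moving frame, with the constants determined by `β₀`: the width of
analyticity shrinks from `β'` at time `0` to `β₀` at time `t`. -/
lemma norm_movingFourierN_sub_prod_le (hΦe : ∀ x, Φ (-x) = Φ x) (hΦ : IsFourierTransform Φ Φhat)
    (hΦ1 : Integrable fun h => ‖h‖ * ‖Φhat h‖) {f₀ : PhysSpace d × PhysSpace d → ℝ}
    {β β' β₀ M α : ℝ} (hβ : 0 < β) (hf₀ : analyticNormOne β' f₀ < ⊤)
    (hM : M = (analyticNormOne β' f₀).toReal) (hM1 : 1 ≤ M) (hα : α = Real.log M + Real.log 2)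
    (hβ₀ : IsBetaZero Φhat α β β' β₀)
    {f : ℝ → PhysSpace d × PhysSpace d → ℝ} (hf : IsVlasovSolution Φ f₀ f)
    {N : ℕ} (hN : 1 ≤ N) {F : ℝ → PhaseSpace d N → ℝ}
    (hF : IsLiouvilleSolution Φ N (tensorPow N f₀) F) {t : ℝ} (ht : |t| < lifespan β β₀)
    (ξ η : Fin N → PhysSpace d) :
    ‖movingFourierN F t ξ η - ∏ i, movingFourierOne f t (ξ i) (η i)‖
      ≤ |t| / lifespan β β₀ / N * ((((activeSet ξ η).card : ℝ) + 1)
        * M ^ (activeSet ξ η).card * Real.exp (-(β₀ * totalFreq ξ η))) := by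
  have hini1 : ∀ ξ η, movingFourierOne f 0 ξ η = symplecticFourierOne f₀ ξ η := fun ξ η => by
    have h1 := movingFourierOne_eq f 0 ξ η
    rw [zero_smul, sub_zero] at h1
    rw [h1, symplecticFourierOne, symplecticFourierOne]
    exact integral_congr_ae (hf.init.mono fun z hz => by simp only [hz])
  have hiniN : ∀ ξ η, movingFourierN F 0 ξ η = ∏ i, movingFourierOne f 0 (ξ i) (η i) :=
    fun ξ η => by
      have h1 := movingFourierN_eq F 0 ξ η
      rw [zero_smul, sub_zero] at h1
      simp_rw [hini1]
      rw [h1, ← symplecticFourier_tensorPow, symplecticFourier, symplecticFourier]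
      exact integral_congr_ae (hF.init.mono fun z hz => by simp only [hz])
  by_cases ht0 : t = 0
  · subst ht0
    simp [hiniN]
  have htpos : 0 < |t| := abs_pos.2 ht0
  have hT : 0 < lifespan β β₀ := htpos.trans ht
  have hδ : 0 < β' - β₀ := sub_pos.2 hβ₀.upper
  have hβ₀pos : 0 < β₀ := hβ.trans hβ₀.lower
  have hexp : Real.exp α = 2 * M := by
    rw [hα, Real.exp_add, Real.exp_log (by linarith), Real.exp_log two_pos]; ring
  have heq := hβ₀.equation
  rw [hexp] at heq
  have key := norm_sub_prod_le (g := movingFourierOne f) (G := movingFourierN F) (T := lifespan β β₀)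
    (b := β') (M := M) (lam := (β' - β₀) / |t|) (t₁ := |t|) (τ := |t| / lifespan β β₀) hN
    hΦ.integrable.aestronglyMeasurable
    (fun s ξ η => norm_movingFourier_le (hf.density s) _ _)
    (fun s => by
      have h1 := movingFourierOne_eq f s 0 0
      rw [smul_zero, sub_zero, symplecticFourierOne_zero (hf.density s)] at h1
      exact h1)
    (fun s => continuous_movingFourier hf.contDiff.continuous hf.density continuous_const
      (by fun_prop) (by fun_prop))
    (hasDerivAt_movingFourierOne hΦ hΦ1 hf)
    (fun s ξ η => norm_movingFourier_le (hF.density s) _ _)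
    (fun s => continuous_movingFourier hF.contDiff.continuous hF.density continuous_const
      (by fun_prop) (by fun_prop))
    (hasDerivAt_movingFourierN hΦe hΦ hΦ1 hF)
    hβ₀.finite (by linarith [hβ₀.upper]) hM1 (by positivity) ht.le
    (by rw [div_mul_cancel₀ _ htpos.ne']; linarith) (by positivity)
    ((div_le_one hT).2 ht.le) (by rw [← heq]; field_simp; ring)
    (fun ξ η => by rw [hini1, hM]; exact norm_symplecticFourierOne_le hf₀ ξ η)
    hiniN le_rfl ξ η
  rwa [div_mul_cancel₀ _ htpos.ne', sub_sub_cancel] at key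

/-- The estimate for the marginals; the constant is smaller than `vlasovConst`. -/
theorem analyticNorm_marginal_sub_tensorPow_le (hΦe : ∀ x, Φ (-x) = Φ x)
    (hΦ : IsFourierTransform Φ Φhat)
    (hΦ1 : Integrable fun h => ‖h‖ * ‖Φhat h‖) {f₀ : PhysSpace d × PhysSpace d → ℝ}
    {β β' β₀ M α : ℝ} (hβ : 0 < β) (hf₀ : analyticNormOne β' f₀ < ⊤)
    (hM : M = (analyticNormOne β' f₀).toReal) (hM1 : 1 ≤ M) (hα : α = Real.log M + Real.log 2)
    (hβ₀ : IsBetaZero Φhat α β β' β₀)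
    {f : ℝ → PhysSpace d × PhysSpace d → ℝ} (hf : IsVlasovSolution Φ f₀ f)
    {j N : ℕ} (hN : 1 ≤ N) (hj : j ≤ N) {F : ℝ → PhaseSpace d N → ℝ}
    (hF : IsLiouvilleSolution Φ N (tensorPow N f₀) F) {t : ℝ} (ht : |t| < lifespan β β₀) :
    analyticNorm β (fun z => marginal j (F t) z - tensorPow j (f t) z)
      ≤ ENNReal.ofReal (|t| / lifespan β β₀ / N * (((j : ℝ) + 1) * M ^ j)) := by
  have hβ₀pos : 0 < β₀ := hβ.trans hβ₀.lower
  have hT : 0 < lifespan β β₀ := (abs_nonneg t).trans_lt ht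
  refine iSup₂_le fun ξ η => ENNReal.ofReal_le_ofReal ?_
  set ξ' : Fin N → PhysSpace d := joinParticles ξ 0
  set η' : Fin N → PhysSpace d := joinParticles (η - t • ξ) 0 with hη'
  have hexp : ∀ g : PhaseSpace d j → ℝ, Integrable g → Integrable fun z => Complex.exp (Complex.I *
      ((∑ i, (inner ℝ (z.1 i) (ξ i) - inner ℝ (z.2 i) (η i)) : ℝ) : ℂ)) * (g z : ℂ) :=
    fun g hg => hg.ofReal.bdd_mul (c := 1) (Continuous.aestronglyMeasurable (by fun_prop))
      (Eventually.of_forall fun z => by rw [mul_comm, Complex.norm_exp_ofReal_mul_I])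
  have hsub : symplecticFourier (fun z => marginal j (F t) z - tensorPow j (f t) z) ξ η
      = movingFourierN F t ξ' η' - ∏ i, movingFourierOne f t (ξ' i) (η' i) := by
    have e1 : symplecticFourier (fun z => marginal j (F t) z - tensorPow j (f t) z) ξ η
        = symplecticFourier (marginal j (F t)) ξ η - symplecticFourier (tensorPow j (f t)) ξ η := by
      rw [symplecticFourier, symplecticFourier, symplecticFourier, ← integral_sub
        (hexp _ (integrable_marginal hj (hF.density t).integrable))
        (hexp _ (integrable_tensorPow j (hf.density t).integrable))]
      refine integral_congr_ae (Eventually.of_forall fun z => ?_)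
      simp only
      push_cast
      ring
    have e2 : ∏ i, movingFourierOne f t (ξ' i) (η' i)
        = ∏ i, symplecticFourierOne (f t) (ξ i) (η i) := by
      rw [← (splitIndex hj).prod_comp, Fintype.prod_sum_type]
      have h0 : movingFourierOne f t 0 0 = 1 := by
        have h1 := movingFourierOne_eq f t 0 0
        rwa [smul_zero, sub_zero, symplecticFourierOne_zero (hf.density t)] at h1
      simp only [ξ', η', joinParticles_inl, joinParticles_inr, Pi.zero_apply, h0,
        Finset.prod_const_one, mul_one, Pi.sub_apply, Pi.smul_apply, movingFourierOne_eq]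
    rw [e1, symplecticFourier_marginal hj (hF.density t).integrable, symplecticFourier_tensorPow,
      ← movingFourierN_eq, e2, hη', joinParticles_sub_smul hj]
  have hmain := norm_movingFourierN_sub_prod_le hΦe hΦ hΦ1 hβ hf₀ hM hM1 hα hβ₀ hf hN hF ht ξ' η'
  rw [hsub]
  have hfreq : β * ∑ i, (‖ξ i‖ + ‖η i‖) ≤ β₀ * totalFreq ξ' η' := by
    rw [totalFreq_joinParticles hj, totalFreq, Finset.mul_sum, Finset.mul_sum]
    refine Finset.sum_le_sum fun i _ => ?_
    -- `β (1 + T) = β₀ (1 - T²) ≤ β₀`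
    have hβT : β * (1 + lifespan β β₀) ≤ β₀ := by
      have : β₀ - β * (1 + lifespan β β₀) = β₀ * lifespan β β₀ ^ 2 := by
        rw [lifespan]; field_simp; ring
      have h2 : 0 ≤ β₀ * lifespan β β₀ ^ 2 := by positivity
      linarith
    have h1 : ‖η i‖ ≤ ‖(η - t • ξ) i‖ + lifespan β β₀ * ‖ξ i‖ := by
      have : η i = (η - t • ξ) i + t • ξ i := by simp
      calc ‖η i‖ ≤ ‖(η - t • ξ) i‖ + ‖t • ξ i‖ := by
            conv_lhs => rw [this]
            exact norm_add_le _ _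
        _ ≤ _ := by rw [norm_smul, Real.norm_eq_abs]; gcongr
    calc β * (‖ξ i‖ + ‖η i‖) ≤ β * (1 + lifespan β β₀) * ‖ξ i‖ + β * ‖(η - t • ξ) i‖ := by
          nlinarith
      _ ≤ β₀ * ‖ξ i‖ + β₀ * ‖(η - t • ξ) i‖ := by
          gcongr
          exact hβ₀.lower.le
      _ = _ := by ring
  have hcard : (activeSet ξ' η').card ≤ j := card_activeSet_joinParticles_le hj _ _
  have hNpos : (0 : ℝ) < N := by exact_mod_cast hN
  calc _ ≤ (|t| / lifespan β β₀ / N * ((((activeSet ξ' η').card : ℝ) + 1)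
        * M ^ (activeSet ξ' η').card * Real.exp (-(β₀ * totalFreq ξ' η'))))
        * Real.exp (β₀ * totalFreq ξ' η') := by gcongr
    _ = |t| / lifespan β β₀ / N * ((((activeSet ξ' η').card : ℝ) + 1)
        * M ^ (activeSet ξ' η').card) := by
        rw [mul_assoc, mul_assoc ((((activeSet ξ' η').card : ℝ) + 1) * _), ← Real.exp_add]
        simp
    _ ≤ _ := by gcongr

end Estimate

/-! ### The lifespan and the constants -/

section Lifespan

open Filter Topology

variable {d : ℕ} {Φ : PhysSpace d → ℝ} {Φhat : PhysSpace d → ℂ} {β β' : ℝ}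

lemma lifespan_eq {x : ℝ} (hx : x ≠ 0) : lifespan β x = 1 - β / x := by
  rw [lifespan]; field_simp

lemma lifespan_mono (hβ : 0 < β) {x y : ℝ} (hx : β ≤ x) (hxy : x ≤ y) :
    lifespan β x ≤ lifespan β y := by
  rw [lifespan_eq (by linarith), lifespan_eq (by linarith)]
  have hx0 : 0 < x := hβ.trans_le hx
  gcongr

lemma lifespan_nonneg (hβ : 0 < β) {x : ℝ} (hx : β ≤ x) : 0 ≤ lifespan β x :=
  div_nonneg (by linarith) (by linarith)

lemma lifespan_mem_Ico (hβ : 0 < β) {x : ℝ} (hx : β ≤ x) (hxβ' : x < β') :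
    lifespan β x ∈ Set.Ico 0 ((β' - β) / β') := by
  refine ⟨lifespan_nonneg hβ hx, ?_⟩
  rw [show (β' - β) / β' = lifespan β β' from rfl, lifespan_eq (by linarith),
    lifespan_eq (by linarith)]
  have hx0 : 0 < x := hβ.trans_le hx
  gcongr

lemma cPhiIntegrand_mono {b s s' : ℝ} (hb : 0 ≤ b) (hs : 0 ≤ s) (hss' : s ≤ s') (h : PhysSpace d) :
    cPhiIntegrand Φhat b s h ≤ cPhiIntegrand Φhat b s' h := by
  unfold cPhiIntegrand
  rw [abs_of_nonneg hs, abs_of_nonneg (hs.trans hss')]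
  gcongr

lemma cPhiIntegrand_nonneg (b s : ℝ) (h : PhysSpace d) : 0 ≤ cPhiIntegrand Φhat b s h := by
  unfold cPhiIntegrand; positivity

/-- If `C_Φ` vanishes, so does the gradient of `Φ`. -/
lemma cPhi_pos (hΦ : IsFourierTransform Φ Φhat) (hΦ1 : Integrable fun h => ‖h‖ * ‖Φhat h‖)
    (hne : ∃ x y, Φ x ≠ Φ y) {b s : ℝ} (hC : Integrable (cPhiIntegrand Φhat b s)) :
    0 < cPhi Φhat b s := by
  refine lt_of_le_of_ne cPhi_nonneg fun h0 => ?_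
  have h1 := (integral_eq_zero_iff_of_nonneg (cPhiIntegrand_nonneg (Φhat := Φhat) b s) hC).1 h0.symm
  have h2 : ∫ h, ‖h‖ * ‖Φhat h‖ = 0 := by
    refine integral_eq_zero_of_ae (h1.mono fun h hh => ?_)
    simpa [cPhiIntegrand, Real.exp_ne_zero] using hh
  obtain ⟨x, y, hxy⟩ := hne
  refine hxy (is_const_of_fderiv_eq_zero (𝕜 := ℝ)
    ((contDiff_of_fourier hΦ.integrable hΦ1 hΦ.inversion).differentiable one_ne_zero)
    (fun z => ?_) x y)
  have h3 := norm_fderiv_le_of_fourier hΦ.integrable hΦ1 hΦ.inversion z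
  rw [h2] at h3
  exact norm_le_zero_iff.1 h3

lemma continuousOn_cPhi (hΦm : AEStronglyMeasurable Φhat) {b s₁ : ℝ} (hb : 0 ≤ b)
    (hC : Integrable (cPhiIntegrand Φhat b s₁)) :
    ContinuousOn (cPhi Φhat b) (Set.Icc 0 s₁) := by
  refine continuousOn_of_dominated (bound := cPhiIntegrand Φhat b s₁) (fun s _ => ?_)
    (fun s hs => Eventually.of_forall fun h => ?_) hC (Eventually.of_forall fun h => ?_)
  · unfold cPhiIntegrand
    refine AEStronglyMeasurable.mul (AEStronglyMeasurable.mul ?_ hΦm.norm) ?_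
    · exact Continuous.aestronglyMeasurable (by fun_prop)
    · exact Continuous.aestronglyMeasurable (by fun_prop)
  · rw [Real.norm_of_nonneg (cPhiIntegrand_nonneg b s h)]
    exact cPhiIntegrand_mono hb hs.1 hs.2 h
  · unfold cPhiIntegrand
    exact Continuous.continuousOn (by fun_prop)

/-- The equation for `β₀` equates a continuous nondecreasing function that vanishes only at `β`
with the decreasing function `β' - β₀`. -/
theorem existsUnique_isBetaZero (hΦ : IsFourierTransform Φ Φhat)
    (hΦ1 : Integrable fun h => ‖h‖ * ‖Φhat h‖) (hβ : 0 < β) (hββ' : β < β') (α : ℝ)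
    (hne : ∃ x y, Φ x ≠ Φ y)
    (hC : ∀ s ∈ Set.Ico 0 ((β' - β) / β'), Integrable (cPhiIntegrand Φhat β' s)) :
    ∃! β₀ : ℝ, IsBetaZero Φhat α β β' β₀ := by
  have hβ' : 0 ≤ β' := by linarith
  set H : ℝ → ℝ := fun x =>
    2 * (1 + lifespan β x) * lifespan β x * cPhi Φhat β' (lifespan β x) * Real.exp α with hH
  have hCx : ∀ x, β ≤ x → x < β' → Integrable (cPhiIntegrand Φhat β' (lifespan β x)) :=
    fun x h1 h2 => hC _ (lifespan_mem_Ico hβ h1 h2)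
  have hmono : ∀ x y, β ≤ x → x ≤ y → y < β' → H x ≤ H y := fun x y h1 h2 h3 => by
    have e1 := lifespan_mono hβ h1 h2
    have e2 := lifespan_nonneg hβ h1
    have e3 : cPhi Φhat β' (lifespan β x) ≤ cPhi Φhat β' (lifespan β y) :=
      integral_mono (hCx x h1 (h2.trans_lt h3)) (hCx y (h1.trans h2) h3)
        fun h => cPhiIntegrand_mono hβ' e2 e1 h
    have e4 : 0 ≤ cPhi Φhat β' (lifespan β x) := cPhi_nonneg
    have e5 := e2.trans e1
    simp only [hH]
    gcongr
  obtain ⟨mid, hm1, hm2⟩ := exists_between hββ'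
  have hc : 0 < H mid := by
    have e1 : 0 < lifespan β mid := div_pos (by linarith) (by linarith)
    have e2 := cPhi_pos hΦ hΦ1 hne (hCx mid hm1.le hm2)
    simp only [hH]
    positivity
  set x₁ := max mid (β' - H mid / 2) with hx₁
  have hx₁m : mid ≤ x₁ := le_max_left _ _
  have hx₁β' : x₁ < β' := max_lt hm2 (by linarith)
  have hcont : ContinuousOn (fun x => H x - (β' - x)) (Set.Icc β x₁) := by
    have hl : ContinuousOn (lifespan β) (Set.Icc β x₁) := by
      unfold lifespan
      exact ContinuousOn.div (by fun_prop) (by fun_prop) fun x hx => by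
        have := hx.1; linarith
    have hcl : ContinuousOn (fun x => cPhi Φhat β' (lifespan β x)) (Set.Icc β x₁) :=
      (continuousOn_cPhi hΦ.integrable.aestronglyMeasurable hβ'
        (hCx x₁ (hm1.le.trans hx₁m) hx₁β')).comp hl fun x hx =>
          ⟨lifespan_nonneg hβ hx.1, lifespan_mono hβ hx.1 hx.2⟩
    simp only [hH]
    fun_prop
  have hβx : β ≤ x₁ := hm1.le.trans hx₁m
  have hQβ : H β - (β' - β) < 0 := by
    have : lifespan β β = 0 := by simp [lifespan]
    simp only [hH, this]
    linarith
  have hQx : 0 ≤ H x₁ - (β' - x₁) := by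
    have h1 := hmono mid x₁ hm1.le hx₁m hx₁β'
    have h2 : β' - H mid / 2 ≤ x₁ := le_max_right _ _
    linarith
  obtain ⟨x, hx, hx0⟩ := intermediate_value_Icc hβx hcont ⟨hQβ.le, hQx⟩
  simp only at hx0
  have hxβ : β < x := lt_of_le_of_ne hx.1 fun h => by subst h; linarith
  have hxβ' : x < β' := hx.2.trans_lt hx₁β'
  refine ⟨x, ⟨hxβ, hxβ', hCx x hxβ.le hxβ', by simp only [hH] at hx0; linarith⟩, fun y hy => ?_⟩
  have hHx : H x = β' - x := by linarith
  have hHy : H y = β' - y := hy.equation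
  rcases lt_trichotomy x y with h | h | h
  · have := hmono x y hxβ.le h.le hy.upper
    linarith
  · exact h.symm
  · have := hmono y x hy.lower.le h.le hxβ'
    linarith

lemma add_one_le_vlasovConst (j : ℕ) {τ : ℝ} (h0 : 0 ≤ τ) (h1 : τ < 1) :
    (j : ℝ) + 1 ≤ vlasovConst j τ := by
  have hγ : 0 ≤ gammaConst j τ := (Real.exp_pos _).le
  have h2 : 0 < 1 - τ := by linarith
  have h3 : (1 - τ) ^ 2 ≤ 1 := pow_le_one₀ h2.le (by linarith)
  have h4 : (j : ℝ) + 1 ≤ ((j : ℝ) + 1) / (1 - τ) ^ 2 :=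
    le_div_self (by positivity) (by positivity) h3
  have h5 : 0 ≤ 2 * τ / (1 - τ) ^ 3 := by positivity
  have h6 : 0 ≤ 4 / (1 - τ) := by positivity
  have h7 : 0 ≤ gammaConst j τ * (((j : ℝ) + 1) / (1 - τ) ^ 2 + 2 * τ / (1 - τ) ^ 3) := by
    positivity
  rw [vlasovConst]
  linarith

/-- The logarithmic restriction on `j` makes the error at most `(j + 1) 4^{-j}`. -/
lemma div_mul_le_of_le_log {M τ : ℝ} (hM : 1 ≤ M) {T t : ℝ} (ht : t ≠ 0) (htT : |t| < T)
    (hτ : τ = |t| / T) {j N : ℕ} (hN : 1 ≤ N)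
    (hj : (j : ℝ) ≤ (Real.log N + Real.log (T / |t|)) /
      (Real.log M + 2 * Real.log 2 + 1 / (Real.exp 1 * Real.log (T / |t|)))) :
    τ / N * (((j : ℝ) + 1) * M ^ j) ≤ (1 / 2) ^ j := by
  have ht0 : 0 < |t| := abs_pos.2 ht
  have hT : 0 < T := ht0.trans htT
  have hNpos : (0 : ℝ) < N := by exact_mod_cast hN
  have hM0 : 0 < M := by linarith
  have hl : 0 < Real.log (T / |t|) := Real.log_pos ((one_lt_div ht0).2 htT)
  have hlM : 0 ≤ Real.log M := Real.log_nonneg hM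
  have hl2 : 0 < Real.log 2 := Real.log_pos one_lt_two
  have hr : 0 ≤ 1 / (Real.exp 1 * Real.log (T / |t|)) := by positivity
  rw [le_div_iff₀ (by positivity)] at hj
  have h1 : (j : ℝ) * (Real.log M + 2 * Real.log 2) ≤ Real.log (N * (T / |t|)) := by
    rw [Real.log_mul hNpos.ne' (by positivity)]
    have : 0 ≤ (j : ℝ) * (1 / (Real.exp 1 * Real.log (T / |t|))) := by positivity
    linarith
  have h2 : M ^ j * 4 ^ j ≤ N * (T / |t|) := by
    rw [← Real.log_le_log_iff (by positivity) (by positivity),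
      Real.log_mul (by positivity) (by positivity), Real.log_pow, Real.log_pow,
      show (4 : ℝ) = 2 ^ 2 by norm_num, Real.log_pow]
    push_cast
    linarith
  have h3 : (j : ℝ) + 1 ≤ 2 ^ j := by exact_mod_cast Nat.lt_two_pow_self
  have h4 : τ / N * (M ^ j * 4 ^ j) ≤ 1 := by
    calc τ / N * (M ^ j * 4 ^ j) ≤ τ / N * (N * (T / |t|)) := by
          gcongr
          rw [hτ]; positivity
      _ = 1 := by rw [hτ]; field_simp
  have h5 : (4 : ℝ) ^ j = 2 ^ j * 2 ^ j := by rw [← mul_pow]; norm_num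
  have hτ0 : 0 ≤ τ := by rw [hτ]; positivity
  calc τ / N * (((j : ℝ) + 1) * M ^ j) ≤ τ / N * (2 ^ j * M ^ j) := by gcongr
    _ = τ / N * (M ^ j * 4 ^ j) * (1 / 2) ^ j := by
      rw [h5, one_div, inv_pow]; field_simp
    _ ≤ 1 * (1 / 2) ^ j := by gcongr
    _ = _ := one_mul _

end Lifespan

theorem mainTheorem3 (d : ℕ) (Φ : PhysSpace d → ℝ) (hΦ_even : ∀ x, Φ (-x) = Φ x)
    (Φhat : PhysSpace d → ℂ) (hΦhat : IsFourierTransform Φ Φhat)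
    (f₀ : PhysSpace d × PhysSpace d → ℝ) (hf₀ : IsProbDensity f₀)
    (β β' : ℝ) (hβ : 0 < β) (hββ' : β < β')
    (hf₀_norm : analyticNormOne β' f₀ < ⊤)
    (hΦ_int : Integrable (fun h : PhysSpace d => ‖h‖ * ‖Φhat h‖ * Real.exp (β' * ‖h‖)))
    (M α : ℝ) (hM : M = (analyticNormOne β' f₀).toReal) (hα : α = Real.log M + Real.log 2) :
    -- `T` is well defined as soon as `Φ` is not constant and `C_Φ^{β'}` is finite
    ((∃ x y, Φ x ≠ Φ y) →
      (∀ s ∈ Set.Ico 0 ((β' - β) / β'), Integrable (cPhiIntegrand Φhat β' s)) →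
      ∃! β₀ : ℝ, IsBetaZero Φhat α β β' β₀) ∧
    ∀ β₀ T : ℝ, IsBetaZero Φhat α β β' β₀ → T = lifespan β β₀ →
      0 < T ∧
      ∀ (f : ℝ → PhysSpace d × PhysSpace d → ℝ) (F : (N : ℕ) → ℝ → PhaseSpace d N → ℝ),
        IsVlasovSolution Φ f₀ f →
        (∀ N : ℕ, 1 ≤ N → IsLiouvilleSolution Φ N (tensorPow N f₀) (F N)) →
        -- the quantitative estimate
        (∀ t : ℝ, |t| < T → ∀ j N : ℕ, 1 ≤ j → j ≤ N →
          analyticNorm β (fun z => marginal j (F N t) z - tensorPow j (f t) z)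
            ≤ ENNReal.ofReal (vlasovConst j (|t| / T) / N * (|t| / T) * M ^ j)) ∧
        -- uniform convergence for `j` up to order `log N`
        (∀ K : Set ℝ, IsCompact K → K ⊆ Set.Ioo (-T) T → ∀ ε : ℝ, 0 < ε →
          ∃ N₀ : ℕ, ∀ N : ℕ, N₀ ≤ N → ∀ t ∈ K, ∀ j : ℕ, 1 ≤ j → j ≤ N →
            (t ≠ 0 → (j : ℝ) ≤ (Real.log N + Real.log (T / |t|)) /
              (Real.log M + 2 * Real.log 2 + 1 / (Real.exp 1 * Real.log (T / |t|)))) →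
            analyticNorm β (fun z => marginal j (F N t) z - tensorPow j (f t) z)
              ≤ ENNReal.ofReal ε) := by
  have hΦ1 : Integrable fun h => ‖h‖ * ‖Φhat h‖ := by
    refine hΦ_int.mono' ((Continuous.aestronglyMeasurable (by fun_prop)).mul
      hΦhat.integrable.aestronglyMeasurable.norm) (Filter.Eventually.of_forall fun h => ?_)
    rw [Real.norm_of_nonneg (by positivity)]
    have : 1 ≤ Real.exp (β' * ‖h‖) :=
      Real.one_le_exp (mul_nonneg (hβ.trans hββ').le (norm_nonneg h))
    exact le_mul_of_one_le_right (by positivity) this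
  have hM1 : 1 ≤ M := by rw [hM]; exact one_le_analyticNormOne hf₀ hf₀_norm
  refine ⟨existsUnique_isBetaZero hΦhat hΦ1 hβ hββ' α, ?_⟩
  rintro β₀ T hβ₀ rfl
  have hT : 0 < lifespan β β₀ :=
    div_pos (sub_pos.2 hβ₀.lower) (hβ.trans hβ₀.lower)
  refine ⟨hT, fun f F hf hF => ?_⟩
  have key : ∀ t : ℝ, |t| < lifespan β β₀ → ∀ j N : ℕ, 1 ≤ N → j ≤ N →
      analyticNorm β (fun z => marginal j (F N t) z - tensorPow j (f t) z)
        ≤ ENNReal.ofReal (|t| / lifespan β β₀ / N * (((j : ℝ) + 1) * M ^ j)) :=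
    fun t ht j N hN hj => analyticNorm_marginal_sub_tensorPow_le hΦ_even hΦhat hΦ1 hβ hf₀_norm hM
      hM1 hα hβ₀ hf hN hj (hF N hN) ht
  refine ⟨fun t ht j N hj hjN => ?_, fun K hK hKT ε hε => ?_⟩
  · refine (key t ht j N (hj.trans hjN) hjN).trans (ENNReal.ofReal_le_ofReal ?_)
    have h1 := add_one_le_vlasovConst j (τ := |t| / lifespan β β₀) (by positivity)
      ((div_lt_one hT).2 ht)
    calc |t| / lifespan β β₀ / N * (((j : ℝ) + 1) * M ^ j)
        ≤ |t| / lifespan β β₀ / N * (vlasovConst j (|t| / lifespan β β₀) * M ^ j) := by gcongr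
      _ = _ := by ring
  · -- large `j` are controlled by the restriction on `j`, the remaining ones by the factor `1 / N`
    obtain ⟨J, hJ⟩ := exists_pow_lt_of_lt_one hε (by norm_num : (1 / 2 : ℝ) < 1)
    obtain ⟨N₀, hN₀⟩ := exists_nat_ge (((J : ℝ) + 1) * M ^ J / ε)
    refine ⟨N₀, fun N hN t ht j hj hjN hlog => ?_⟩
    have hN1 : 1 ≤ N := hj.trans hjN
    have hNpos : (0 : ℝ) < N := by exact_mod_cast hN1
    have htT : |t| < lifespan β β₀ := abs_lt.2 (hKT ht)
    refine (key t htT j N hN1 hjN).trans (ENNReal.ofReal_le_ofReal ?_)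
    by_cases ht0 : t = 0
    · subst ht0; simpa using hε.le
    rcases le_total J j with h | h
    · refine (div_mul_le_of_le_log hM1 ht0 htT rfl hN1 (hlog ht0)).trans (le_trans ?_ hJ.le)
      exact pow_le_pow_of_le_one (by norm_num) (by norm_num) h
    · have h1 : ((J : ℝ) + 1) * M ^ J ≤ ε * N := by
        rw [div_le_iff₀ hε] at hN₀
        have : (N₀ : ℝ) ≤ N := by exact_mod_cast hN
        nlinarith
      have h2 : |t| / lifespan β β₀ ≤ 1 := (div_le_one hT).2 htT.le
      calc |t| / lifespan β β₀ / N * (((j : ℝ) + 1) * M ^ j)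
          ≤ 1 / N * (((J : ℝ) + 1) * M ^ J) := by gcongr
        _ ≤ 1 / N * (ε * N) := by gcongr
        _ = ε := by field_simp
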